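/- Let $D=\{z\in\mathbb C:\operatorname{Re}z\le\frac12,\ \operatorname{Im}z>0,\ |z-1|\le1\}$; a point $z\in D$ represents the similarity class of the triangle with vertices $0,1,z$ (longest edge $[0,1]$, shortest edge $[0,z]$). Cut $D$ into the closed regions $\mathrm{I}$: $\operatorname{Re}z\ge\frac14,\ |z-\frac12|\ge\frac12$; $\mathrm{II}$: $\operatorname{Re}z\le\frac14,\ |z|\ge\frac12$; $\mathrm{III}$: $|z|\le\frac12\le|z-\frac12|$; $\mathrm{IV}$: $|z-\frac12|\le\frac12\le|z|$; $\mathrm{V}$: $\operatorname{Re}z\le\frac14,\ |z-\frac12|\le\frac12$; $\mathrm{VI}$: $\operatorname{Re}z\ge\frac14,\ |z|\le\frac12$. Longest edge bisection is described by the maps $L,R:D\to D$ (left and right triangle), $$L(z)=\tfrac{1}{2\bar z},\ \tfrac{-1}{2z-1},\ \tfrac{2\bar z}{2\bar z-1},\ \tfrac{2z-1}{2z},\ 2z,\ 1-2\bar z\quad\text{on }\mathrm{I},\mathrm{II},\mathrm{III},\mathrm{IV},\mathrm{V},\mathrm{VI}\text{ respectively},$$ $$R(z)=\tfrac{-1}{2z-2}\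 \text{on }\mathrm{I}\cup\mathrm{II}\cup\mathrm{III},\qquad R(z)=\tfrac{2\bar z-1}{2\bar z-2}\ \text{on }\mathrm{IV}\cup\mathrm{V}\cup\mathrm{VI}$$ (the formulas agree on common boundaries). Let $\mathrm{LEB}(z)$ be the orbit of $z$, i.e. the smallest set containing $z$ and closed under $L$ and $R$. The terminal region is $\mathcal A=\mathrm{I}\cup R(\mathrm{I})$; the terminal quadruples in $\mathrm{LEB}(z)$ are the sets $\mathrm{LEB}(w)$ with $w\in\mathrm{LEB}(z)\cap\mathcal A$, and $q(z)$ is the number of distinct ones. The bisection graph $G(z)$ is the following directed graph. If for every $w\in \mathrm{LEB}(z)$ the points $w,L(w),R(w)$ are distinct, its vertex set is $\mathrm{LEB}(z)$ and its edges are $(w,L(w))$, labelled $L$, and $(w,R(w))$, labelled $R$. In general, loops and double edges are resolved by splitting points of $\mathrm{LEB}(z)$; unless said otherwise, all copies of a point have the same outgoing edges: 1. A point $w\notin\mathcal A$ with $R(w)=w$ is replaced by $w_1,w_2$; the loop becomes the edges $(w_1,w_2),(w_2,w_1)$ labelled $R$, and the other incoming edges of $w$ go to $w_1$. 2. The points of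 $\mathcal A$ with a loop come in pairs $w,w'$ with $L(w)=w$, $R(w)=w'$, $R(w')=w'$, $L(w')=w$. They are replaced by $w_1,w_2,w_1',w_2'$; the loops become 2-cycles $w_1\leftrightarrow w_2$ (labelled $L$) and $w'_1\leftrightarrow w'_2$ (labelled $R$); there are edges $(w_i,w_i')$ labelled $R$ and $(w_i',w_i)$ labelled $L$ for $i=1,2$; incoming edges from other points to $w$ (resp. $w'$) go to $w_1$ (resp. $w_1'$). 3. A point $w$ for which there is $u\in\mathrm{LEB}(z)$ with $L(u)=R(u)=w$ is replaced by $w_L,w_R$; incoming edges labelled $L$ go to $w_L$, those labelled $R$ go to $w_R$. The point $\zeta=\frac12+\frac12i$, which satisfies $L(\zeta)=R(\zeta)=\zeta$, is first split by 3 and the resulting pair $w=\zeta_L$, $w'=\zeta_R$ is then resolved by 2, giving four vertices. Let $A$ be the adjacency matrix of $G(z)$: $A_{ij}=1$ if $(j,i)$ is an edge, and $A_{ij}=0$ otherwise. **Lemma.** For every $z\in D$ the graph $G(z)$ is finite, and the real matrix $A$ satisfies: (a) $2$ is an eigenvalue of $A$, and it is the spectral radius of $A$ (the maximal absolute value of a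 complex eigenvalue). (b) The eigenspaces $E_2$ and $E_{-2}$ of $A$ for $2$ and $-2$ satisfy $\dim E_2=\dim E_{-2}=q(z)$. Moreover $\pm2$ have no nontrivial Jordan blocks, i.e. the generalized eigenspace of $A$ for $2$ (resp. $-2$) equals $E_2$ (resp. $E_{-2}$). -/

import Mathlib

namespace LEB

/-- The normalized region: similarity classes of nondegenerate triangles correspond to the points
`z` of this set, `z` standing for the triangle with vertices `0`, `1`, `z`, whose longest edge is
`[0, 1]` and whose shortest edge is `[0, z]`. -/
def D : Set ℂ := {z | z.re ≤ 1 / 2 ∧ 0 < z.im ∧ ‖z - 1‖ ≤ 1}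

/-! The six closed subregions of `D` cut out by the geodesics `re z = 1 / 4`, `|z| = 1 / 2` and
`|z - 1 / 2| = 1 / 2`. -/

def regionI : Set ℂ := {z | z ∈ D ∧ 1 / 4 ≤ z.re ∧ 1 / 2 ≤ ‖z - 1 / 2‖}

def regionII : Set ℂ := {z | z ∈ D ∧ z.re ≤ 1 / 4 ∧ 1 / 2 ≤ ‖z‖}

def regionIII : Set ℂ := {z | z ∈ D ∧ ‖z‖ ≤ 1 / 2 ∧ 1 / 2 ≤ ‖z - 1 / 2‖}

def regionIV : Set ℂ := {z | z ∈ D ∧ 1 / 2 ≤ ‖z‖ ∧ ‖z - 1 / 2‖ ≤ 1 / 2}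

def regionV : Set ℂ := {z | z ∈ D ∧ z.re ≤ 1 / 4 ∧ ‖z - 1 / 2‖ ≤ 1 / 2}

def regionVI : Set ℂ := {z | z ∈ D ∧ 1 / 4 ≤ z.re ∧ ‖z‖ ≤ 1 / 2}

open scoped Classical ComplexConjugate in
/-- The (normalized) left triangle of the longest edge bisection of `z`. The six closed regions
cover `D` and the formulas agree on common boundaries, so the order of the cases is irrelevant;
the last case is region `VI` (and a dummy value outside `D`). -/
noncomputable def L (z : ℂ) : ℂ :=
  if z ∈ regionI then 1 / (2 * conj z)
  else if z ∈ regionII then -1 / (2 * z - 1)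
  else if z ∈ regionIII then (2 * conj z) / (2 * conj z - 1)
  else if z ∈ regionIV then (2 * z - 1) / (2 * z)
  else if z ∈ regionV then 2 * z
  else 1 - 2 * conj z

open scoped Classical ComplexConjugate in
/-- The (normalized) right triangle of the longest edge bisection of `z`. The last case is
`IV ∪ V ∪ VI` (and a dummy value outside `D`). -/
noncomputable def R (z : ℂ) : ℂ :=
  if z ∈ regionI ∪ regionII ∪ regionIII then -1 / (2 * z - 2)
  else (2 * conj z - 1) / (2 * conj z - 2)

/-- The orbit `LEB(z)`: everything obtained from `z` by finitely many applications of `L`, `R`. -/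
def orbit (z : ℂ) : Set ℂ := {w | Relation.ReflTransGen (fun u v => v = L u ∨ v = R u) z w}

/-- The terminal region `A = I ∪ R(I)`. -/
def terminalRegion : Set ℂ := regionI ∪ R '' regionI

/-- The terminal quadruples arising from `z`: the orbits of the members of `LEB(z)` that lie in
the terminal region. -/
def terminalQuadruples (z : ℂ) : Set (Set ℂ) := {Q | ∃ w ∈ orbit z ∩ terminalRegion, Q = orbit w}

/-- The number `q(z)` of terminal quadruples arising from `z`. -/
noncomputable def q (z : ℂ) : ℕ := (terminalQuadruples z).ncard

/-- The edge labels of the bisection graph. -/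
inductive Side
  | left
  | right

/-- The bisection map belonging to a label. -/
noncomputable def bis : Side → ℂ → ℂ
  | .left => L
  | .right => R

/-- The other label. -/
def Side.other : Side → Side
  | .left => .right
  | .right => .left

/-- Names for the vertices that represent one point of the orbit.
* `single`: the point is not split;
* `loop s i`: a point `w` with a loop labelled `s` is split into `w₁` (`i = false`) and `w₂`
  (`i = true`);
* `double s`: a point `w` that receives both edges of some point is split into `w_L` (`s = left`)
  and `w_R` (`s = right`). -/
inductive Copy
  | single
  | loop (s : Side) (i : Bool)
  | double (s : Side)

/-- `w` receives a double edge from some point of `LEB(z)`. -/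
def IsDoubleTarget (z w : ℂ) : Prop := ∃ u ∈ orbit z, L u = w ∧ R u = w

/-- Which copies of a point `w` of `LEB(z)` are vertices of the bisection graph. Among the
points of `D`, only `ζ = 1 / 2 + i / 2` has more than one of the features (loop labelled `L`, loop
labelled `R`, target of a double edge). It has all three; it is first split into `ζ_L`, `ζ_R` as
a target of a double edge, and then, `ζ_L` having a loop labelled `L` and `ζ_R` a loop labelled
`R`, it is resolved as a pair of loops, so that it gets the four copies `loop s i`. -/
def IsCopy (z w : ℂ) : Copy → Prop
  | .loop s _ => bis s w = w
  | .double _ => L w ≠ w ∧ R w ≠ w ∧ IsDoubleTarget z w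
  | .single => L w ≠ w ∧ R w ≠ w ∧ ¬ IsDoubleTarget z w

/-- The vertices of the bisection graph of `z`. -/
def Vertex (z : ℂ) : Type := {p : ℂ × Copy // p.1 ∈ orbit z ∧ IsCopy z p.1 p.2}

open scoped Classical in
/-- The copy of `w` to which an edge labelled `s` coming from elsewhere is directed. -/
noncomputable def entry (z : ℂ) (s : Side) (w : ℂ) : Copy :=
  if bis s w = w then .loop s false
  else if bis s.other w = w then .loop s.other false
  else if IsDoubleTarget z w then .double s
  else .single

open scoped Classical in
/-- The end of the edge labelled `s` that starts at the copy `c` of the point `w`.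
* A loop labelled `s` becomes a 2-cycle between `loop s false` and `loop s true`.
* For a pair of loops in the terminal region, the edges between the two points are duplicated.
* Otherwise all copies have the same outgoing edges. -/
noncomputable def target (z : ℂ) (s : Side) : ℂ × Copy → ℂ × Copy
  | (w, .loop .left i) =>
    match s with
    | .left => (w, .loop .left (!i))
    | .right =>
      if w ∈ terminalRegion then (R w, .loop .right i) else (R w, entry z .right (R w))
  | (w, .loop .right i) =>
    match s with
    | .right => (w, .loop .right (!i))
    | .left =>
      if w ∈ terminalRegion then (L w, .loop .left i) else (L w, entry z .left (L w))
  | (w, .double _) => (bis s w, entry z s (bis s w))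
  | (w, .single) => (bis s w, entry z s (bis s w))

/-- The directed edges of the bisection graph of `z`. -/
def Edge (z : ℂ) (u v : Vertex z) : Prop := ∃ s : Side, v.1 = target z s u.1

open scoped Classical in
/-- The adjacency matrix of the bisection graph: the entry `(i, j)` is `1` if `(j, i)` is an edge
and `0` otherwise. -/
noncomputable def adjMatrix (z : ℂ) : Matrix (Vertex z) (Vertex z) ℝ :=
  Matrix.of fun i j => if Edge z j i then 1 else 0

end LEB

/-!
The points of `D` are handled through the pair `(re z, |z|²)`: in these coordinates `D`, the six
regions and their boundaries are given by linear conditions, and `L` and `R` are projective maps.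

*The orbits.* Let `outer = I ∪ II ∪ III` and `inner = IV ∪ V ∪ VI`. The map `R` sends `outer` to
`IV` and is an involution of `inner`, and on `outer` one has `L (R z) = z` and `L (R (R z)) = L z`.
So for `z` in `outer` the orbit of `z` is the orbit of `L z` together with `z`, `R z`, `R (R z)`;
the iterates of `L` leave `III`, since `L` halves `im z / |z|²` there, and `L` maps `II` into `I`.
For `z` in `inner` the orbit is made up of `z`, `R z` and the orbits of `L z` and `L (R z)`, and
these two points are in `outer` or else higher than `z` by a fixed factor greater than `1`. As the
height is bounded, every orbit is finite and meets region `I` (`tame_of_mem_D`).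

*The terminal region.* For `u` in `I` the orbit of `u` is `u, L u, R u, R (L u)`. An analysis of
the fixed points of `L` and `R` and of the solutions of `L u = R u` shows that, after the splitting
of points, the vertices over this orbit always form the same graph, a 4-cycle with edges in both
directions (`next_corner`, `exists_eq_corner`), however many of the four points coincide; and that
the two edges starting at a vertex have different ends (`next_left_ne_next_right`).

*The matrix.* Hence all column sums of `A` are `2`. The `ℓ¹`-norm at most doubles under `A`, which
excludes Jordan blocks for `±2`, and a left eigenvector evaluated at its maximum shows that no
eigenvalue exceeds `2` in absolute value. A left eigenvector for `±2` has constant absolute value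
along the edges that start where it is maximal, so it is determined by its values at one vertex of
each terminal quadruple; this bounds the dimensions of the eigenspaces from above by `q z`. The
functions `1, ε, ε, 1` on the 4-cycles, with `ε = ±1`, are independent right eigenvectors for `2 ε`
and give the bound from below.
-/

namespace LEB

/-! ### The regions in coordinates -/

section Coordinates

open Complex ComplexConjugate

theorem normSq_eq (z : ℂ) : normSq z = z.re ^ 2 + z.im ^ 2 := by
  rw [normSq_apply]; ring

theorem norm_le_half_iff (z : ℂ) : ‖z‖ ≤ 1 / 2 ↔ normSq z ≤ 1 / 4 := by
  rw [normSq_eq_norm_sq]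
  constructor <;> intro h <;> nlinarith [norm_nonneg z]

theorem half_le_norm_iff (z : ℂ) : 1 / 2 ≤ ‖z‖ ↔ 1 / 4 ≤ normSq z := by
  rw [normSq_eq_norm_sq]
  constructor <;> intro h <;> nlinarith [norm_nonneg z]

theorem norm_sub_half_le_iff (z : ℂ) : ‖z - 1 / 2‖ ≤ 1 / 2 ↔ normSq z ≤ z.re := by
  rw [norm_le_half_iff, normSq_eq, normSq_eq]
  simp
  constructor <;> intro h <;> nlinarith

theorem half_le_norm_sub_half_iff (z : ℂ) : 1 / 2 ≤ ‖z - 1 / 2‖ ↔ z.re ≤ normSq z := by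
  rw [half_le_norm_iff, normSq_eq, normSq_eq]
  simp
  constructor <;> intro h <;> nlinarith

theorem mem_D {z : ℂ} : z ∈ D ↔ z.re ≤ 1 / 2 ∧ 0 < z.im ∧ normSq z ≤ 2 * z.re := by
  have : ‖z - 1‖ ≤ 1 ↔ normSq z ≤ 2 * z.re := by
    have h : ‖z - 1‖ ^ 2 = normSq z - 2 * z.re + 1 := by
      rw [← normSq_eq_norm_sq, normSq_eq, normSq_eq]; simp; ring
    constructor <;> intro h' <;> nlinarith [norm_nonneg (z - 1)]
  simp only [D, Set.mem_ofPred_eq, this]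

theorem mem_regionI {z : ℂ} : z ∈ regionI ↔ z ∈ D ∧ 1 / 4 ≤ z.re ∧ z.re ≤ normSq z := by
  simp only [regionI, Set.mem_ofPred_eq, half_le_norm_sub_half_iff]

theorem mem_regionII {z : ℂ} : z ∈ regionII ↔ z ∈ D ∧ z.re ≤ 1 / 4 ∧ 1 / 4 ≤ normSq z := by
  simp only [regionII, Set.mem_ofPred_eq, half_le_norm_iff]

theorem mem_regionIII {z : ℂ} :
    z ∈ regionIII ↔ z ∈ D ∧ normSq z ≤ 1 / 4 ∧ z.re ≤ normSq z := by
  simp only [regionIII, Set.mem_ofPred_eq, half_le_norm_sub_half_iff, norm_le_half_iff]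

theorem mem_regionIV {z : ℂ} : z ∈ regionIV ↔ z ∈ D ∧ 1 / 4 ≤ normSq z ∧ normSq z ≤ z.re := by
  simp only [regionIV, Set.mem_ofPred_eq, norm_sub_half_le_iff, half_le_norm_iff]

theorem mem_regionV {z : ℂ} : z ∈ regionV ↔ z ∈ D ∧ z.re ≤ 1 / 4 ∧ normSq z ≤ z.re := by
  simp only [regionV, Set.mem_ofPred_eq, norm_sub_half_le_iff]

theorem mem_regionVI {z : ℂ} : z ∈ regionVI ↔ z ∈ D ∧ 1 / 4 ≤ z.re ∧ normSq z ≤ 1 / 4 := by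
  simp only [regionVI, Set.mem_ofPred_eq, norm_le_half_iff]

/-- The union `I ∪ II ∪ III`, the part of `D` on or outside the circle `|z - 1 / 2| = 1 / 2`. -/
def outer : Set ℂ := {z | z ∈ D ∧ z.re ≤ normSq z}

/-- The union `IV ∪ V ∪ VI`, the part of `D` on or inside the circle `|z - 1 / 2| = 1 / 2`. -/
def inner : Set ℂ := {z | z ∈ D ∧ normSq z ≤ z.re}

theorem outer_or_inner {z : ℂ} (h : z ∈ D) : z ∈ outer ∨ z ∈ inner := by
  rcases le_total z.re (normSq z) with h' | h'
  · exact Or.inl ⟨h, h'⟩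
  · exact Or.inr ⟨h, h'⟩

theorem outer_cases {z : ℂ} (h : z ∈ outer) :
    z ∈ regionI ∨ z ∈ regionII ∨ z ∈ regionIII := by
  obtain ⟨h, h'⟩ := h
  simp only [mem_regionI, mem_regionII, mem_regionIII, h, true_and]
  grind

theorem inner_cases {z : ℂ} (h : z ∈ inner) :
    z ∈ regionIV ∨ z ∈ regionV ∨ z ∈ regionVI := by
  obtain ⟨h, h'⟩ := h
  simp only [mem_regionIV, mem_regionV, mem_regionVI, h, true_and]
  grind

theorem regionI_sub_outer {z : ℂ} (h : z ∈ regionI) : z ∈ outer :=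
  ⟨h.1, (mem_regionI.1 h).2.2⟩

theorem regionII_sub_outer {z : ℂ} (h : z ∈ regionII) : z ∈ outer := by
  obtain ⟨h, h1, h2⟩ := mem_regionII.1 h
  exact ⟨h, h1.trans h2⟩

theorem regionIII_sub_outer {z : ℂ} (h : z ∈ regionIII) : z ∈ outer :=
  ⟨h.1, (mem_regionIII.1 h).2.2⟩

theorem regionIV_sub_inner {z : ℂ} (h : z ∈ regionIV) : z ∈ inner :=
  ⟨h.1, (mem_regionIV.1 h).2.2⟩

/-- The point `w` has real part `x`, imaginary part `y` and squared absolute value `n`. The number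
`n` is redundant, but the regions are cut out by linear conditions on `x` and `n`. -/
def Coords (w : ℂ) (x y n : ℝ) : Prop := w.re = x ∧ w.im = y ∧ normSq w = n

theorem Coords.ext {w w' : ℂ} {x y n x' y' n' : ℝ} (h : Coords w x y n) (h' : Coords w' x' y' n')
    (hx : x = x') (hy : y = y') : w = w' :=
  Complex.ext (by rw [h.1, h'.1, hx]) (by rw [h.2.1, h'.2.1, hy])

/-- The denominators of the formulas for `L` and `R` do not vanish on the upper half plane. -/
theorem denominators_pos {z : ℂ} (h : z ∈ D) : 0 < normSq z ∧ 0 < 4 * normSq z - 4 * z.re + 1 ∧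
    0 < normSq z - 2 * z.re + 1 ∧ normSq z = z.re ^ 2 + z.im ^ 2 := by
  have hy : 0 < z.im := (mem_D.1 h).2.1
  have := normSq_eq z
  refine ⟨?_, ?_, ?_, this⟩
  · rw [this]; positivity
  · nlinarith [sq_nonneg (2 * z.re - 1), pow_pos hy 2]
  · nlinarith [sq_nonneg (z.re - 1), pow_pos hy 2]

theorem re_pos {z : ℂ} (h : z ∈ D) : 0 < z.re := by
  linarith [(denominators_pos h).1, (mem_D.1 h).2.2]

theorem coords_of_mul_eq {w u v : ℂ} (h : w * v = u) (hv : 0 < normSq v) :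
    Coords w ((u.re * v.re + u.im * v.im) / normSq v) ((u.im * v.re - u.re * v.im) / normSq v)
      (normSq u / normSq v) := by
  have hv' : v ≠ 0 := normSq_pos.1 hv
  refine ⟨?_, ?_, ?_⟩
  · rw [← h, eq_div_iff hv.ne', normSq_apply]; simp; ring
  · rw [← h, eq_div_iff hv.ne', normSq_apply]; simp; ring
  · rw [← h, normSq_mul, mul_div_cancel_right₀ _ hv.ne']

theorem coords_div {u v : ℂ} (hv : 0 < normSq v) :
    Coords (u / v) ((u.re * v.re + u.im * v.im) / normSq v)
      ((u.im * v.re - u.re * v.im) / normSq v) (normSq u / normSq v) :=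
  coords_of_mul_eq (div_mul_cancel₀ _ (normSq_pos.1 hv)) hv

theorem normSq_two_mul_sub_one (z : ℂ) : normSq (2 * z - 1) = 4 * normSq z - 4 * z.re + 1 := by
  simp [normSq_apply]; ring

theorem normSq_two_mul_sub_two (z : ℂ) :
    normSq (2 * z - 2) = 4 * (normSq z - 2 * z.re + 1) := by
  simp [normSq_apply]; ring

theorem normSq_two_mul_conj_sub_one (z : ℂ) :
    normSq (2 * conj z - 1) = 4 * normSq z - 4 * z.re + 1 := by
  simp [normSq_apply]; ring

theorem normSq_two_mul_conj_sub_two (z : ℂ) :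
    normSq (2 * conj z - 2) = 4 * (normSq z - 2 * z.re + 1) := by
  simp [normSq_apply]; ring

theorem Coords.congr {w : ℂ} {x y n x' y' n' : ℝ} (h : Coords w x y n)
    (hx : x = x') (hy : y = y') (hn : n = n') : Coords w x' y' n' := hx ▸ hy ▸ hn ▸ h

/-! ### The bisection maps in coordinates -/

/-! In the following formulas, as in those for `R`, the numerators and the common denominator are
affine functions of `re z` and `normSq z`, apart from `2 * z.im`. Where regions overlap, the
formulas for the earlier regions in the definition of `L` are brought to the stated form. -/

theorem L_I {z : ℂ} (h : z ∈ regionI) :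
    Coords (L z) (2 * z.re / (4 * normSq z)) (2 * z.im / (4 * normSq z))
      (1 / (4 * normSq z)) := by
  obtain ⟨h0, -, -, -⟩ := denominators_pos h.1
  have e : normSq (2 * conj z) = 4 * normSq z := by simp; norm_num
  rw [L, if_pos h]
  refine (coords_div (by rw [e]; positivity)).congr ?_ ?_ ?_ <;> rw [e] <;> simp

theorem L_II {z : ℂ} (h : z ∈ regionII) :
    Coords (L z) ((1 - 2 * z.re) / (4 * normSq z - 4 * z.re + 1))
      (2 * z.im / (4 * normSq z - 4 * z.re + 1)) (1 / (4 * normSq z - 4 * z.re + 1)) := by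
  obtain ⟨h0, h1, h2, hn⟩ := denominators_pos h.1
  by_cases hI : z ∈ regionI
  · have hx : z.re = 1 / 4 := le_antisymm (mem_regionII.1 h).2.1 (mem_regionI.1 hI).2.1
    refine (L_I hI).congr ?_ ?_ ?_ <;> rw [hx] <;> ring
  · rw [L, if_neg hI, if_pos h]
    have e := normSq_two_mul_sub_one z
    refine (coords_div (by rw [e]; positivity)).congr ?_ ?_ ?_ <;> rw [e] <;> simp

theorem L_III {z : ℂ} (h : z ∈ regionIII) :
    Coords (L z) ((4 * normSq z - 2 * z.re) / (4 * normSq z - 4 * z.re + 1))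
      (2 * z.im / (4 * normSq z - 4 * z.re + 1))
      (4 * normSq z / (4 * normSq z - 4 * z.re + 1)) := by
  obtain ⟨h0, h1, h2, hn⟩ := denominators_pos h.1
  obtain ⟨-, h3, h4⟩ := mem_regionIII.1 h
  by_cases hI : z ∈ regionI
  · have hx : z.re = 1 / 4 := by linarith [(mem_regionI.1 hI).2.1]
    have hn : normSq z = 1 / 4 := by linarith [(mem_regionI.1 hI).2.1]
    refine (L_I hI).congr ?_ ?_ ?_ <;> rw [hx, hn] <;> norm_num
  by_cases hII : z ∈ regionII
  · have hn : normSq z = 1 / 4 := by linarith [(mem_regionII.1 hII).2.2]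
    refine (L_II hII).congr ?_ ?_ ?_ <;> rw [hn] <;> norm_num
  · rw [L, if_neg hI, if_neg hII, if_pos h]
    have e := normSq_two_mul_conj_sub_one z
    refine (coords_div (by rw [e]; positivity)).congr ?_ ?_ ?_ <;> rw [e] <;>
      simp [normSq_apply] <;> ring

theorem L_IV {z : ℂ} (h : z ∈ regionIV) :
    Coords (L z) ((4 * normSq z - 2 * z.re) / (4 * normSq z))
      (2 * z.im / (4 * normSq z))
      ((4 * normSq z - 4 * z.re + 1) / (4 * normSq z)) := by
  obtain ⟨h0, h1, h2, hn⟩ := denominators_pos h.1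
  obtain ⟨-, h3, h4⟩ := mem_regionIV.1 h
  by_cases hI : z ∈ regionI
  · have hn : normSq z = z.re := by linarith [(mem_regionI.1 hI).2.2]
    refine (L_I hI).congr ?_ ?_ ?_ <;> rw [hn] <;> ring
  by_cases hII : z ∈ regionII
  · have hx : z.re = 1 / 4 := by linarith [(mem_regionII.1 hII).2.1]
    have hn : normSq z = 1 / 4 := by linarith [(mem_regionII.1 hII).2.1]
    refine (L_II hII).congr ?_ ?_ ?_ <;> rw [hx, hn] <;> norm_num
  by_cases hIII : z ∈ regionIII
  · have hx : z.re = 1 / 4 := by linarith [(mem_regionIII.1 hIII).2.1, (mem_regionIII.1 hIII).2.2]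
    have hn : normSq z = 1 / 4 := by
      linarith [(mem_regionIII.1 hIII).2.1, (mem_regionIII.1 hIII).2.2]
    refine (L_III hIII).congr ?_ ?_ ?_ <;> rw [hx, hn] <;> norm_num
  · rw [L, if_neg hI, if_neg hII, if_neg hIII, if_pos h]
    have e : normSq (2 * z) = 4 * normSq z := by simp; norm_num
    refine (coords_div (by rw [e]; positivity)).congr ?_ ?_ ?_ <;> rw [e] <;>
      simp [normSq_apply] <;> ring

theorem L_V {z : ℂ} (h : z ∈ regionV) :
    Coords (L z) (2 * z.re) (2 * z.im) (4 * normSq z) := by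
  obtain ⟨h0, h1, h2, hn⟩ := denominators_pos h.1
  obtain ⟨-, h3, h4⟩ := mem_regionV.1 h
  by_cases hI : z ∈ regionI
  · have hx : z.re = 1 / 4 := by linarith [(mem_regionI.1 hI).2.1]
    have hn : normSq z = 1 / 4 := by linarith [(mem_regionI.1 hI).2.1, (mem_regionI.1 hI).2.2]
    refine (L_I hI).congr ?_ ?_ ?_ <;> rw [hn] <;> norm_num
  by_cases hII : z ∈ regionII
  · have hx : z.re = 1 / 4 := by linarith [(mem_regionII.1 hII).2.2]
    have hn : normSq z = 1 / 4 := by linarith [(mem_regionII.1 hII).2.2]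
    refine (L_II hII).congr ?_ ?_ ?_ <;> rw [hx, hn] <;> norm_num
  by_cases hIII : z ∈ regionIII
  · have hn : normSq z = z.re := by
      linarith [(mem_regionIII.1 hIII).2.1, (mem_regionIII.1 hIII).2.2]
    refine (L_III hIII).congr ?_ ?_ ?_ <;> rw [hn] <;> norm_num
    ring
  by_cases hIV : z ∈ regionIV
  · have hx : z.re = 1 / 4 := by linarith [(mem_regionIV.1 hIV).2.1]
    have hn : normSq z = 1 / 4 := by linarith [(mem_regionIV.1 hIV).2.1]
    refine (L_IV hIV).congr ?_ ?_ ?_ <;> norm_num [hx, hn]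
  · rw [L, if_neg hI, if_neg hII, if_neg hIII, if_neg hIV, if_pos h]
    refine ⟨by simp, by simp, by simp; norm_num⟩

theorem L_VI {z : ℂ} (h : z ∈ regionVI) :
    Coords (L z) (1 - 2 * z.re) (2 * z.im) (4 * normSq z - 4 * z.re + 1) := by
  obtain ⟨h0, h1, h2, hn⟩ := denominators_pos h.1
  obtain ⟨-, h3, h4⟩ := mem_regionVI.1 h
  by_cases hI : z ∈ regionI
  · have hx : z.re = 1 / 4 := by linarith [(mem_regionI.1 hI).2.2]
    have hn : normSq z = 1 / 4 := by linarith [(mem_regionI.1 hI).2.1, (mem_regionI.1 hI).2.2]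
    refine (L_I hI).congr ?_ ?_ ?_ <;> rw [hn] <;> norm_num <;> linarith
  by_cases hII : z ∈ regionII
  · have hx : z.re = 1 / 4 := by linarith [(mem_regionII.1 hII).2.1]
    have hn : normSq z = 1 / 4 := by linarith [(mem_regionII.1 hII).2.2]
    refine (L_II hII).congr ?_ ?_ ?_ <;> rw [hx, hn] <;> norm_num
  by_cases hIII : z ∈ regionIII
  · have hx : z.re = 1 / 4 := by linarith [(mem_regionIII.1 hIII).2.1, (mem_regionIII.1 hIII).2.2]
    have hn : normSq z = 1 / 4 := by
      linarith [(mem_regionIII.1 hIII).2.1, (mem_regionIII.1 hIII).2.2]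
    refine (L_III hIII).congr ?_ ?_ ?_ <;> rw [hx, hn] <;> norm_num
  by_cases hIV : z ∈ regionIV
  · have hn : normSq z = 1 / 4 := by linarith [(mem_regionIV.1 hIV).2.1]
    refine (L_IV hIV).congr ?_ ?_ ?_ <;> rw [hn] <;> norm_num
  by_cases hV : z ∈ regionV
  · have hx : z.re = 1 / 4 := by linarith [(mem_regionV.1 hV).2.1]
    refine (L_V hV).congr ?_ ?_ ?_ <;> norm_num [hx]
  · rw [L, if_neg hI, if_neg hII, if_neg hIII, if_neg hIV, if_neg hV]
    refine ⟨by simp, by simp, ?_⟩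
    simp [normSq_apply]; ring

theorem R_outer {z : ℂ} (h : z ∈ outer) :
    Coords (R z) ((2 - 2 * z.re) / (4 * (normSq z - 2 * z.re + 1)))
      (2 * z.im / (4 * (normSq z - 2 * z.re + 1))) (1 / (4 * (normSq z - 2 * z.re + 1))) := by
  obtain ⟨h0, h1, h2, hn⟩ := denominators_pos h.1
  have h' : z ∈ regionI ∪ regionII ∪ regionIII := by
    have := outer_cases h
    simp only [Set.mem_union]; tauto
  rw [R, if_pos h']
  have e := normSq_two_mul_sub_two z
  refine (coords_div (by rw [e]; positivity)).congr ?_ ?_ ?_ <;> rw [e] <;> simp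

theorem R_inner {z : ℂ} (h : z ∈ inner) :
    Coords (R z) ((4 * normSq z - 6 * z.re + 2) / (4 * (normSq z - 2 * z.re + 1)))
      (2 * z.im / (4 * (normSq z - 2 * z.re + 1)))
      ((4 * normSq z - 4 * z.re + 1) / (4 * (normSq z - 2 * z.re + 1))) := by
  obtain ⟨h0, h1, h2, hn⟩ := denominators_pos h.1
  by_cases ho : z ∈ outer
  · have hn : normSq z = z.re := le_antisymm h.2 ho.2
    refine (R_outer ho).congr ?_ ?_ ?_ <;> rw [hn] <;> ring
  · have h' : z ∉ regionI ∪ regionII ∪ regionIII := by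
      rintro ((h' | h') | h')
      exacts [ho (regionI_sub_outer h'), ho (regionII_sub_outer h'), ho (regionIII_sub_outer h')]
    rw [R, if_neg h']
    have e := normSq_two_mul_conj_sub_two z
    have e' := normSq_two_mul_conj_sub_one z
    refine (coords_div (by rw [e]; positivity)).congr ?_ ?_ ?_
    · rw [e]; simp [normSq_apply]; ring
    · rw [e]; simp; ring
    · rw [e, e']

end Coordinates

section Dynamics

open Complex

/-! ### Images of the regions and composition of the maps -/

theorem mem_inner {z : ℂ} : z ∈ inner ↔ z.re ≤ 1 / 2 ∧ 0 < z.im ∧ normSq z ≤ z.re := by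
  constructor
  · rintro ⟨h, h'⟩
    exact ⟨(mem_D.1 h).1, (mem_D.1 h).2.1, h'⟩
  · rintro ⟨h1, h2, h3⟩
    refine ⟨mem_D.2 ⟨h1, h2, ?_⟩, h3⟩
    linarith [normSq_nonneg z]

theorem R_outer_mem {z : ℂ} (h : z ∈ outer) : R z ∈ regionIV := by
  obtain ⟨h0, h1, h2, hn⟩ := denominators_pos h.1
  obtain ⟨h3, h4, h5⟩ := mem_D.1 h.1
  obtain ⟨hx, hy, hN⟩ := R_outer h
  have hle : normSq (R z) ≤ (R z).re := by
    rw [hx, hN]; gcongr; linarith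
  have hin : R z ∈ inner := mem_inner.2 ⟨by
    rw [hx, div_le_iff₀ (by positivity)]; linarith [h.2], by rw [hy]; positivity, hle⟩
  refine mem_regionIV.2 ⟨hin.1, ?_, hle⟩
  rw [hN, le_div_iff₀ (by positivity)]; linarith

theorem R_inner_mem {z : ℂ} (h : z ∈ inner) : R z ∈ inner := by
  obtain ⟨h0, h1, h2, hn⟩ := denominators_pos h.1
  obtain ⟨h3, h4, h5⟩ := mem_inner.1 h
  obtain ⟨hx, hy, hN⟩ := R_inner h
  refine mem_inner.2 ⟨?_, by rw [hy]; positivity, ?_⟩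
  · rw [hx, div_le_iff₀ (by positivity)]; linarith
  · rw [hx, hN]; gcongr ?_ / _; linarith

theorem R_mem_inner {z : ℂ} (h : z ∈ D) : R z ∈ inner := by
  rcases outer_or_inner h with h | h
  · exact regionIV_sub_inner (R_outer_mem h)
  · exact R_inner_mem h

theorem R_R_of_inner {z : ℂ} (h : z ∈ inner) : R (R z) = z := by
  obtain ⟨-, -, h2, -⟩ := denominators_pos h.1
  have hR := R_inner h
  have hRR := R_inner (R_inner_mem h)
  rw [hR.1, hR.2.1, hR.2.2] at hRR
  clear hR
  generalize hd : normSq z - 2 * z.re + 1 = d at *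
  have hn : normSq z = d + 2 * z.re - 1 := by linarith
  have e : (4 * normSq z - 4 * z.re + 1) / (4 * d) -
      2 * ((4 * normSq z - 6 * z.re + 2) / (4 * d)) + 1 = 1 / (4 * d) := by
    rw [hn]; field_simp; ring
  rw [e] at hRR
  refine hRR.ext ⟨rfl, rfl, rfl⟩ ?_ ?_
  · rw [hn]; field_simp; ring
  · field_simp; ring

/-- On `outer` the map `R` is injective with image region `IV`, where `L` is its inverse. -/
theorem L_R_of_outer {z : ℂ} (h : z ∈ outer) : L (R z) = z := by
  obtain ⟨h0, h1, h2, hn⟩ := denominators_pos h.1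
  have hR := R_outer h
  have hL := L_IV (R_outer_mem h)
  rw [hR.1, hR.2.1, hR.2.2] at hL
  refine hL.ext ⟨rfl, rfl, rfl⟩ ?_ ?_
  · field_simp; ring
  · field_simp; ring

theorem L_IV_mem {z : ℂ} (h : z ∈ regionIV) : L z ∈ outer := by
  obtain ⟨h0, h1, h2, hn⟩ := denominators_pos h.1
  obtain ⟨h3, h4, h5⟩ := mem_D.1 h.1
  obtain ⟨-, h6, h7⟩ := mem_regionIV.1 h
  obtain ⟨hx, hy, hN⟩ := L_IV h
  have := re_pos h.1
  refine ⟨mem_D.2 ⟨?_, by rw [hy]; positivity, ?_⟩, ?_⟩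
  · rw [hx, div_le_iff₀ (by positivity)]; linarith
  · rw [hx, hN, mul_div_assoc']; gcongr ?_ / _; linarith
  · rw [hx, hN]; gcongr ?_ / _; linarith

theorem L_I_mem {z : ℂ} (h : z ∈ regionI) : L z ∈ regionI := by
  obtain ⟨h0, h1, h2, hn⟩ := denominators_pos h.1
  obtain ⟨h3, h4, h5⟩ := mem_D.1 h.1
  obtain ⟨-, h6, h7⟩ := mem_regionI.1 h
  obtain ⟨hx, hy, hN⟩ := L_I h
  refine mem_regionI.2 ⟨mem_D.2 ⟨?_, by rw [hy]; positivity, ?_⟩, ?_, ?_⟩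
  · rw [hx, div_le_iff₀ (by positivity)]; linarith
  · rw [hx, hN, mul_div_assoc']; gcongr ?_ / _; linarith
  · rw [hx, le_div_iff₀ (by positivity)]; linarith
  · rw [hx, hN]; gcongr ?_ / _; linarith

theorem L_L_of_I {z : ℂ} (h : z ∈ regionI) : L (L z) = z := by
  obtain ⟨h0, h1, h2, hn⟩ := denominators_pos h.1
  have hL := L_I h
  have hLL := L_I (L_I_mem h)
  rw [hL.1, hL.2.1, hL.2.2] at hLL
  refine hLL.ext ⟨rfl, rfl, rfl⟩ ?_ ?_ <;> field_simp <;> ring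

theorem L_II_mem {z : ℂ} (h : z ∈ regionII) : L z ∈ regionI := by
  obtain ⟨h0, h1, h2, hn⟩ := denominators_pos h.1
  obtain ⟨h3, h4, h5⟩ := mem_D.1 h.1
  obtain ⟨-, h6, h7⟩ := mem_regionII.1 h
  obtain ⟨hx, hy, hN⟩ := L_II h
  refine mem_regionI.2 ⟨mem_D.2 ⟨?_, by rw [hy]; positivity, ?_⟩, ?_, ?_⟩
  · rw [hx, div_le_iff₀ (by positivity)]; linarith
  · rw [hx, hN, mul_div_assoc']; gcongr ?_ / _; linarith
  · rw [hx, le_div_iff₀ (by positivity)]; linarith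
  · rw [hx, hN]; gcongr ?_ / _; linarith [re_pos h.1]

theorem L_III_mem {z : ℂ} (h : z ∈ regionIII) : L z ∈ outer := by
  obtain ⟨h0, h1, h2, hn⟩ := denominators_pos h.1
  obtain ⟨h3, h4, h5⟩ := mem_D.1 h.1
  obtain ⟨-, h6, h7⟩ := mem_regionIII.1 h
  obtain ⟨hx, hy, hN⟩ := L_III h
  refine ⟨mem_D.2 ⟨?_, by rw [hy]; positivity, ?_⟩, ?_⟩
  · rw [hx, div_le_iff₀ (by positivity)]; linarith
  · rw [hx, hN, mul_div_assoc']; gcongr ?_ / _; linarith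
  · rw [hx, hN]; gcongr ?_ / _; linarith [re_pos h.1]

theorem L_outer_mem {z : ℂ} (h : z ∈ outer) : L z ∈ outer := by
  rcases outer_cases h with h | h | h
  · exact regionI_sub_outer (L_I_mem h)
  · exact regionI_sub_outer (L_II_mem h)
  · exact L_III_mem h

/-- On `V ∪ VI` the map `L` is a similarity of ratio `2` preserving the real axis. -/
theorem L_V_or_VI {z : ℂ} (h : z ∈ regionV ∨ z ∈ regionVI) : L z ∈ D ∧ (L z).im = 2 * z.im := by
  rcases h with h | h
  · obtain ⟨h3, h4, h5⟩ := mem_D.1 h.1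
    obtain ⟨-, h6, h7⟩ := mem_regionV.1 h
    obtain ⟨hx, hy, hN⟩ := L_V h
    refine ⟨mem_D.2 ⟨?_, ?_, ?_⟩, hy⟩ <;> simp only [hx, hy, hN] <;> linarith
  · obtain ⟨h3, h4, h5⟩ := mem_D.1 h.1
    obtain ⟨-, h6, h7⟩ := mem_regionVI.1 h
    obtain ⟨hx, hy, hN⟩ := L_VI h
    refine ⟨mem_D.2 ⟨?_, ?_, ?_⟩, hy⟩ <;> simp only [hx, hy, hN] <;> linarith

theorem L_mem_D {z : ℂ} (h : z ∈ D) : L z ∈ D := by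
  rcases outer_or_inner h with h | h
  · exact (L_outer_mem h).1
  · rcases inner_cases h with h | h
    · exact (L_IV_mem h).1
    · exact (L_V_or_VI h).1

theorem R_mem_D {z : ℂ} (h : z ∈ D) : R z ∈ D := (R_mem_inner h).1

theorem R_R_outer_coords {z : ℂ} (h : z ∈ outer) :
    Coords (R (R z)) ((4 * normSq z - 2 * z.re) / (2 * (4 * normSq z - 4 * z.re + 1)))
      (z.im / (4 * normSq z - 4 * z.re + 1)) (normSq z / (4 * normSq z - 4 * z.re + 1)) := by
  obtain ⟨h0, h1, h2, hn⟩ := denominators_pos h.1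
  have hR := R_outer h
  have hRR := R_inner (regionIV_sub_inner (R_outer_mem h))
  rw [hR.1, hR.2.1, hR.2.2] at hRR
  have e : 1 / (4 * (normSq z - 2 * z.re + 1)) -
      2 * ((2 - 2 * z.re) / (4 * (normSq z - 2 * z.re + 1))) + 1 =
      (4 * normSq z - 4 * z.re + 1) / (4 * (normSq z - 2 * z.re + 1)) := by
    field_simp; ring
  rw [e] at hRR
  refine hRR.congr ?_ ?_ ?_
  · field_simp; ring
  · field_simp; ring
  · field_simp; ring

/-- On `I ∪ II ∪ III` the point `R (R z)` is the reflection of `R z`, and it has the same left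
triangle as `z`. Hence the orbit of `z` only grows along the iterates of `L`. -/
theorem L_R_R_of_outer {z : ℂ} (h : z ∈ outer) : L (R (R z)) = L z := by
  obtain ⟨h0, h1, h2, hn⟩ := denominators_pos h.1
  have hRR := R_R_outer_coords h
  have hin := R_inner_mem (regionIV_sub_inner (R_outer_mem h))
  rcases outer_cases h with hI | hII | hIII
  · obtain ⟨-, h6, h7⟩ := mem_regionI.1 hI
    have hIV : R (R z) ∈ regionIV := by
      refine mem_regionIV.2 ⟨hin.1, ?_, hin.2⟩
      rw [hRR.2.2, le_div_iff₀ h1]; linarith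
    have hL := L_IV hIV
    rw [hRR.1, hRR.2.1, hRR.2.2] at hL
    refine hL.ext (L_I hI) ?_ ?_ <;> generalize he : 4 * normSq z - 4 * z.re + 1 = e at *
    · field_simp; ring
    · field_simp
  · obtain ⟨-, h6, h7⟩ := mem_regionII.1 hII
    have hVI : R (R z) ∈ regionVI := by
      refine mem_regionVI.2 ⟨hin.1, ?_, ?_⟩
      · rw [hRR.1, le_div_iff₀ (by positivity)]; linarith
      · rw [hRR.2.2, div_le_iff₀ h1]; linarith
    have hL := L_VI hVI
    rw [hRR.1, hRR.2.1, hRR.2.2] at hL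
    refine hL.ext (L_II hII) ?_ ?_ <;> generalize he : 4 * normSq z - 4 * z.re + 1 = e at *
    · field_simp; linarith
    · field_simp
  · obtain ⟨-, h6, h7⟩ := mem_regionIII.1 hIII
    have hV : R (R z) ∈ regionV := by
      refine mem_regionV.2 ⟨hin.1, ?_, hin.2⟩
      rw [hRR.1, div_le_iff₀ (by positivity)]; linarith
    have hL := L_V hV
    rw [hRR.1, hRR.2.1, hRR.2.2] at hL
    refine hL.ext (L_III hIII) ?_ ?_ <;> generalize he : 4 * normSq z - 4 * z.re + 1 = e at *
    · field_simp
    · field_simp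

theorem R_L_of_I {z : ℂ} (h : z ∈ regionI) : R (L z) = R (R z) := by
  obtain ⟨h0, h1, h2, hn⟩ := denominators_pos h.1
  have hL := L_I h
  have hR := R_outer (regionI_sub_outer (L_I_mem h))
  rw [hL.1, hL.2.1, hL.2.2] at hR
  have e : 1 / (4 * normSq z) - 2 * (2 * z.re / (4 * normSq z)) + 1 =
      (4 * normSq z - 4 * z.re + 1) / (4 * normSq z) := by
    field_simp; ring
  rw [e] at hR
  refine hR.ext (R_R_outer_coords (regionI_sub_outer h)) ?_ ?_
  · field_simp; ring
  · field_simp; ring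

/-! ### Orbits -/

theorem self_mem_orbit (z : ℂ) : z ∈ orbit z := Relation.ReflTransGen.refl

theorem L_mem_orbit {z w : ℂ} (h : w ∈ orbit z) : L w ∈ orbit z :=
  Relation.ReflTransGen.tail h (Or.inl rfl)

theorem R_mem_orbit {z w : ℂ} (h : w ∈ orbit z) : R w ∈ orbit z :=
  Relation.ReflTransGen.tail h (Or.inr rfl)

theorem orbit_subset {z : ℂ} {s : Set ℂ} (h : z ∈ s) (hL : ∀ w ∈ s, L w ∈ s)
    (hR : ∀ w ∈ s, R w ∈ s) : orbit z ⊆ s := by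
  intro w hw
  induction hw with
  | refl => exact h
  | tail _ hab ih =>
    rcases hab with rfl | rfl
    exacts [hL _ ih, hR _ ih]

theorem orbit_subset_orbit {z w : ℂ} (h : w ∈ orbit z) : orbit w ⊆ orbit z :=
  orbit_subset h (fun _ => L_mem_orbit) (fun _ => R_mem_orbit)

theorem orbit_subset_D {z : ℂ} (h : z ∈ D) : orbit z ⊆ D :=
  orbit_subset h (fun _ => L_mem_D) (fun _ => R_mem_D)

/-- The property to be shown for all points of `D`: the orbit is finite and reaches region `I`. -/
def Tame (z : ℂ) : Prop := (orbit z).Finite ∧ (orbit z ∩ regionI).Nonempty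

theorem orbit_subset_of_I {z : ℂ} (h : z ∈ regionI) : orbit z ⊆ {z, L z, R z, R (L z)} := by
  have hL := L_L_of_I h
  have hR := L_R_of_outer (regionI_sub_outer h)
  have hR' := L_R_of_outer (regionI_sub_outer (L_I_mem h))
  have hRR := R_L_of_I h
  have hRR' := R_L_of_I (L_I_mem h)
  rw [hL] at hRR'
  refine orbit_subset (by simp) ?_ ?_ <;>
    simp only [Set.mem_insert_iff, Set.mem_singleton_iff]
  · rintro w (rfl | rfl | rfl | rfl) <;> simp [hL, hR, hR']
  · rintro w (rfl | rfl | rfl | rfl)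
    · simp
    · simp
    · simp [hRR]
    · simp [← hRR']

theorem tame_of_I {z : ℂ} (h : z ∈ regionI) : Tame z :=
  ⟨(Set.toFinite _).subset (orbit_subset_of_I h), z, self_mem_orbit z, h⟩

/-- Below `z ∈ outer` the orbit consists of `z, R z, R (R z)` and the orbit of `L z`, because the
left triangles of `R z` and `R (R z)` are `z` and `L z`. -/
theorem tame_of_outer_step {z : ℂ} (h : z ∈ outer) (hL : Tame (L z)) : Tame z := by
  have hsub : orbit z ⊆ {z, R z, R (R z)} ∪ orbit (L z) := by
    have h1 := L_R_of_outer h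
    have h2 := R_R_of_inner (regionIV_sub_inner (R_outer_mem h))
    have h3 := L_R_R_of_outer h
    refine orbit_subset (by simp) ?_ ?_
    · rintro w ((rfl | rfl | rfl) | hw)
      · exact Or.inr (self_mem_orbit _)
      · rw [h1]; simp
      · rw [h3]; exact Or.inr (self_mem_orbit _)
      · exact Or.inr (L_mem_orbit hw)
    · rintro w ((rfl | rfl | rfl) | hw)
      · simp
      · simp
      · rw [h2]; simp
      · exact Or.inr (R_mem_orbit hw)
  refine ⟨((Set.toFinite _).union hL.1).subset hsub, hL.2.mono ?_⟩
  exact Set.inter_subset_inter_left _ (orbit_subset_orbit (L_mem_orbit (self_mem_orbit z)))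

/-- On region `III` the map `L` halves `im z / |z|²`, while this quantity is at least `√3` there;
so the iterates of `L` leave `III`. -/
theorem tame_of_outer {z : ℂ} (h : z ∈ outer) : Tame z := by
  have key : ∀ k : ℕ, ∀ z ∈ outer, z.im < 2 ^ k * normSq z → Tame z := by
    intro k
    induction k with
    | zero =>
      intro z h hlt
      rcases outer_cases h with h | h | h
      · exact tame_of_I h
      · exact tame_of_outer_step (regionII_sub_outer h) (tame_of_I (L_II_mem h))
      · obtain ⟨h0, h1, h2, hn⟩ := denominators_pos h.1
        obtain ⟨h3, h4, h5⟩ := mem_D.1 h.1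
        obtain ⟨-, h6, h7⟩ := mem_regionIII.1 h
        have := re_pos h.1
        -- Here `z.im ^ 2 ≥ normSq z * (1 - normSq z) > normSq z ^ 2`.
        exfalso
        nlinarith
    | succ k ih =>
      intro z h hlt
      rcases outer_cases h with h | h | h
      · exact tame_of_I h
      · exact tame_of_outer_step (regionII_sub_outer h) (tame_of_I (L_II_mem h))
      · obtain ⟨h0, h1, h2, hn⟩ := denominators_pos h.1
        refine tame_of_outer_step (regionIII_sub_outer h) (ih _ (L_III_mem h) ?_)
        obtain ⟨hx, hy, hN⟩ := L_III h
        rw [hy, hN, mul_div_assoc']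
        gcongr ?_ / _
        rw [pow_succ] at hlt
        linarith
  obtain ⟨h0, -⟩ := denominators_pos h.1
  obtain ⟨k, hk⟩ := pow_unbounded_of_one_lt (z.im / normSq z) one_lt_two
  exact key k z h ((div_lt_iff₀ h0).1 hk)

/-- As `R` is an involution of `inner`, the orbit below `z ∈ inner` consists of `z, R z` and the
orbits of their left triangles. -/
theorem tame_of_inner_step {z : ℂ} (h : z ∈ inner) (hL : Tame (L z)) (hLR : Tame (L (R z))) :
    Tame z := by
  have hsub : orbit z ⊆ {z, R z} ∪ (orbit (L z) ∪ orbit (L (R z))) := by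
    refine orbit_subset (by simp) ?_ ?_
    · rintro w ((rfl | rfl) | hw | hw)
      · exact Or.inr (Or.inl (self_mem_orbit _))
      · exact Or.inr (Or.inr (self_mem_orbit _))
      · exact Or.inr (Or.inl (L_mem_orbit hw))
      · exact Or.inr (Or.inr (L_mem_orbit hw))
    · rintro w ((rfl | rfl) | hw | hw)
      · simp
      · rw [R_R_of_inner h]; simp
      · exact Or.inr (Or.inl (R_mem_orbit hw))
      · exact Or.inr (Or.inr (R_mem_orbit hw))
  refine ⟨((Set.toFinite _).union (hL.1.union hLR.1)).subset hsub, hL.2.mono ?_⟩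
  exact Set.inter_subset_inter_left _ (orbit_subset_orbit (L_mem_orbit (self_mem_orbit z)))

/-- On `IV ∪ V ∪ VI`, where `R` is an involution, both `L z` and `L (R z)` either lie in
`I ∪ II ∪ III` or are higher than `z` by a factor bounded away from `1`, and the height is
bounded. -/
theorem tame_of_inner {z : ℂ} (h : z ∈ inner) : Tame z := by
  obtain ⟨t, ht, htz⟩ : ∃ t : ℝ, 0 < t ∧ t = z.im := ⟨z.im, (mem_inner.1 h).2.1, rfl⟩
  have key : ∀ k : ℕ, ∀ z ∈ inner, t ≤ z.im → 1 ≤ (1 + t ^ 2) ^ k * z.im → Tame z := by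
    intro k
    induction k with
    | zero =>
      intro z h _ hlt
      obtain ⟨h0, h1, h2, hn⟩ := denominators_pos h.1
      obtain ⟨h3, h4, h5⟩ := mem_inner.1 h
      -- The height of `inner` is `1 / 2`.
      exfalso
      nlinarith
    | succ k ih =>
      intro z h htz hlt
      obtain ⟨h0, h1, h2, hn⟩ := denominators_pos h.1
      obtain ⟨h3, h4, h5⟩ := mem_inner.1 h
      -- `t ^ 2 ≤ |z|² ≤ re z`, so `|z - 1|²`, the denominator of `R`, is at most `1 - t ^ 2`.
      have htx : t ^ 2 ≤ z.re := by nlinarith [sq_nonneg z.re]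
      have next : ∀ w ∈ inner, (1 + t ^ 2) * z.im ≤ 2 * w.im → Tame (L w) := by
        intro w hw hle
        rcases inner_cases hw with hIV | hV
        · exact tame_of_outer (L_IV_mem hIV)
        · obtain ⟨hD, him⟩ := L_V_or_VI hV
          rcases outer_or_inner hD with hD | hD
          · exact tame_of_outer hD
          · have : t ≤ (L w).im := by
              rw [him]; nlinarith [mul_nonneg (sq_nonneg t) h4.le]
            refine ih _ hD this ?_
            rw [him]
            calc 1 ≤ (1 + t ^ 2) ^ k * ((1 + t ^ 2) * z.im) := by
                  rw [← mul_assoc, ← pow_succ]; exact hlt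
              _ ≤ _ := by gcongr
      refine tame_of_inner_step h (next z h ?_) (next (R z) (R_inner_mem h) ?_)
      · nlinarith
      · rw [(R_inner h).2.1, mul_div_assoc', le_div_iff₀ (by positivity)]
        have : (1 + t ^ 2) * (normSq z - 2 * z.re + 1) ≤ 1 := by nlinarith [sq_nonneg t]
        nlinarith
  obtain ⟨k, hk⟩ := pow_unbounded_of_one_lt (1 / t) (show 1 < 1 + t ^ 2 by nlinarith [pow_pos ht 2])
  rw [div_lt_iff₀ ht] at hk
  exact key k z h htz.le (by rw [← htz]; exact hk.le)

theorem tame_of_mem_D {z : ℂ} (h : z ∈ D) : Tame z :=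
  (outer_or_inner h).elim tame_of_outer tame_of_inner

end Dynamics

/-! ### Spectra of matrices with two edges at every vertex -/

section Spectra

open Matrix

/-- A left eigenvector for the eigenvalue `μ = ±2` vanishes if it vanishes on a set of vertices
which can be reached from everywhere: the set where its absolute value is maximal is closed under
the edges. -/
theorem left_eigenvector_eq_zero {V : Type*} [Fintype V] (t₁ t₂ : V → V) {μ : ℝ}
    (hμ : |μ| = 2) {f : V → ℝ}
    (hf : ∀ v, f (t₁ v) + f (t₂ v) = μ * f v)
    (hreach : ∀ v, ∃ w, Relation.ReflTransGen (fun a b => b = t₁ a ∨ b = t₂ a) v w ∧ f w = 0) :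
    f = 0 := by
  ext u
  obtain ⟨v, -, hv⟩ := Finset.exists_max_image Finset.univ (fun v => |f v|) ⟨u, Finset.mem_univ u⟩
  obtain ⟨w, hw, hw0⟩ := hreach v
  have key : |f w| = |f v| := by
    clear hw0
    induction hw with
    | refl => rfl
    | tail _ hab ih =>
      rename_i a b _
      have h1 := hv (t₁ a) (Finset.mem_univ _)
      have h2 := hv (t₂ a) (Finset.mem_univ _)
      have h3 : 2 * |f v| ≤ |f (t₁ a)| + |f (t₂ a)| := by
        rw [← ih, ← hμ, ← abs_mul, ← hf a]
        exact abs_add_le _ _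
      rcases hab with rfl | rfl <;> linarith
  have := hv u (Finset.mem_univ u)
  rw [← key, hw0, abs_zero] at this
  simpa using this

section StepMatrix

variable {V : Type*} [Fintype V] [DecidableEq V]

/-- The adjacency matrix, with multiplicities, of the directed graph on `V` with the two edges
`v → t₁ v` and `v → t₂ v` at every vertex; columns belong to the starting points of edges. -/
def stepMatrix (K : Type*) [Semiring K] (t₁ t₂ : V → V) : Matrix V V K :=
  Matrix.of fun i j => (if i = t₁ j then 1 else 0) + (if i = t₂ j then 1 else 0)

theorem vecMul_stepMatrix {K : Type*} [CommRing K] (t₁ t₂ : V → V) (f : V → K) (v : V) :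
    (f ᵥ* stepMatrix K t₁ t₂) v = f (t₁ v) + f (t₂ v) := by
  simp [Matrix.vecMul, dotProduct, stepMatrix, mul_add, Finset.sum_add_distrib]

theorem stepMatrix_mulVec_single {K : Type*} [CommRing K] (t₁ t₂ : V → V) (v : V) :
    stepMatrix K t₁ t₂ *ᵥ Pi.single v 1 = Pi.single (t₁ v) 1 + Pi.single (t₂ v) 1 := by
  ext i
  simp [stepMatrix, Pi.single_apply]

theorem sum_abs_stepMatrix_mulVec_le (t₁ t₂ : V → V) (x : V → ℝ) :
    ∑ i, |(stepMatrix ℝ t₁ t₂ *ᵥ x) i| ≤ 2 * ∑ i, |x i| := by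
  have h0 : ∀ i j, 0 ≤ stepMatrix ℝ t₁ t₂ i j := by
    intro i j
    simp only [stepMatrix, of_apply]
    positivity
  calc ∑ i, |(stepMatrix ℝ t₁ t₂ *ᵥ x) i|
      ≤ ∑ i, ∑ j, stepMatrix ℝ t₁ t₂ i j * |x j| := by
        gcongr with i
        refine (Finset.abs_sum_le_sum_abs _ _).trans (Finset.sum_le_sum fun j _ => ?_)
        rw [abs_mul, abs_of_nonneg (h0 i j)]
    _ = ((fun _ => 1) ᵥ* stepMatrix ℝ t₁ t₂) ⬝ᵥ fun j => |x j| := by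
        rw [Finset.sum_comm]
        simp [dotProduct, Matrix.vecMul, Finset.sum_mul]
    _ = 2 * ∑ i, |x i| := by
        simp only [dotProduct, vecMul_stepMatrix, Finset.mul_sum]
        norm_num

/-- Complex eigenvalues of a step matrix have absolute value at most `2`: a left eigenvector is a
function `f` with `f (t₁ v) + f (t₂ v) = k * f v`, to be evaluated where `‖f‖` is maximal. -/
theorem norm_le_two_of_mem_spectrum (t₁ t₂ : V → V) {k : ℂ}
    (hk : k ∈ spectrum ℂ (stepMatrix ℂ t₁ t₂)) : ‖k‖ ≤ 2 := by
  rw [spectrum.mem_iff, Matrix.isUnit_iff_isUnit_det, isUnit_iff_ne_zero, not_not,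
    ← Matrix.exists_vecMul_eq_zero_iff] at hk
  obtain ⟨f, hf0, hf⟩ := hk
  have hf' : ∀ v, k * f v = f (t₁ v) + f (t₂ v) := by
    intro v
    have := congrFun hf v
    rw [Matrix.vecMul_sub, Pi.sub_apply, vecMul_stepMatrix, Pi.zero_apply, sub_eq_zero,
      Algebra.algebraMap_eq_smul_one, Matrix.vecMul_smul, Matrix.vecMul_one] at this
    simpa using this
  obtain ⟨u, hu⟩ := Function.ne_iff.1 hf0
  obtain ⟨v, -, hv⟩ := Finset.exists_max_image Finset.univ (fun v => ‖f v‖) ⟨u, Finset.mem_univ u⟩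
  have hpos : 0 < ‖f v‖ := (norm_pos_iff.2 hu).trans_le (hv u (Finset.mem_univ u))
  have : ‖k‖ * ‖f v‖ ≤ 2 * ‖f v‖ := by
    rw [← norm_mul, hf' v, two_mul]
    exact (norm_add_le _ _).trans
      (add_le_add (hv _ (Finset.mem_univ _)) (hv _ (Finset.mem_univ _)))
  exact le_of_mul_le_mul_right this hpos

theorem two_mem_spectrum [Nonempty V] (t₁ t₂ : V → V) :
    (2 : ℂ) ∈ spectrum ℂ (stepMatrix ℂ t₁ t₂) := by
  rw [spectrum.mem_iff, Matrix.isUnit_iff_isUnit_det, isUnit_iff_ne_zero, not_not,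
    ← Matrix.exists_vecMul_eq_zero_iff]
  refine ⟨fun _ => 1, fun h => ?_, ?_⟩
  · simpa using congrFun h (Classical.arbitrary V)
  · ext v
    rw [Matrix.vecMul_sub, Pi.sub_apply, vecMul_stepMatrix, Pi.zero_apply, sub_eq_zero,
      Algebra.algebraMap_eq_smul_one, Matrix.vecMul_smul, Matrix.vecMul_one]
    norm_num

theorem spectralRadius_stepMatrix [Nonempty V] (t₁ t₂ : V → V) :
    spectralRadius ℂ (stepMatrix ℂ t₁ t₂) = 2 := by
  apply le_antisymm
  · refine iSup₂_le fun k hk => ?_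
    have := norm_le_two_of_mem_spectrum t₁ t₂ hk
    exact_mod_cast this
  · have := le_iSup₂ (f := fun (k : ℂ) (_ : k ∈ spectrum ℂ (stepMatrix ℂ t₁ t₂)) =>
      (‖k‖₊ : ENNReal)) 2 (two_mem_spectrum t₁ t₂)
    simpa [spectralRadius] using this

/-- Powers of a step matrix grow at most like `2 ^ n` in the `ℓ¹`-norm, so an eigenvalue of
absolute value `2` has no Jordan chain of length two. -/
theorem stepMatrix_no_jordan_chain (t₁ t₂ : V → V) {μ : ℝ} (hμ : |μ| = 2) {x y : V → ℝ}
    (hx : stepMatrix ℝ t₁ t₂ *ᵥ x = μ • x + y) (hy : stepMatrix ℝ t₁ t₂ *ᵥ y = μ • y) : y = 0 := by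
  set M := stepMatrix ℝ t₁ t₂
  -- The factor `μ` in front avoids the exponent `n - 1` in `M ^ n x = μ ^ n x + n μ ^ (n - 1) y`.
  have hpow : ∀ n : ℕ, μ • ((M ^ n) *ᵥ x) = μ ^ n • (μ • x + (n : ℝ) • y) := by
    intro n
    induction n with
    | zero => simp
    | succ n ih =>
      rw [pow_succ', ← Matrix.mulVec_mulVec, ← Matrix.mulVec_smul, ih]
      simp only [Matrix.mulVec_smul, Matrix.mulVec_add, hx, hy]
      ext i
      simp only [Pi.smul_apply, Pi.add_apply, smul_eq_mul]
      push_cast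
      ring
  have hle : ∀ n : ℕ, ∑ i, |((M ^ n) *ᵥ x) i| ≤ 2 ^ n * ∑ i, |x i| := by
    intro n
    induction n with
    | zero => simp
    | succ n ih =>
      rw [pow_succ', ← Matrix.mulVec_mulVec]
      refine (sum_abs_stepMatrix_mulVec_le t₁ t₂ _).trans ?_
      rw [pow_succ']
      linarith
  have hb : ∀ n : ℕ, n • ∑ i, |y i| ≤ 4 * ∑ i, |x i| := by
    intro n
    have h1 : ∀ i, 2 ^ n * (n * |y i|) ≤ 2 * |((M ^ n) *ᵥ x) i| + 2 ^ n * (2 * |x i|) := by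
      intro i
      have h2 : μ ^ n * (n * y i) = μ * ((M ^ n) *ᵥ x) i - μ ^ n * (μ * x i) := by
        have := congrFun (hpow n) i
        simp only [Pi.smul_apply, Pi.add_apply, smul_eq_mul] at this
        rw [this]; ring
      have h3 := abs_sub (μ * ((M ^ n) *ᵥ x) i) (μ ^ n * (μ * x i))
      rw [← h2] at h3
      simpa [abs_mul, abs_pow, hμ] using h3
    have h4 := Finset.sum_le_sum fun i (_ : i ∈ Finset.univ) => h1 i
    rw [Finset.sum_add_distrib] at h4
    simp only [← Finset.mul_sum] at h4
    have h5 : (2 : ℝ) ^ n * (n * ∑ i, |y i|) ≤ 2 ^ n * (4 * ∑ i, |x i|) := by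
      linarith [hle n]
    rw [nsmul_eq_mul]
    exact le_of_mul_le_mul_left h5 (by positivity)
  have h0 : ∑ i, |y i| ≤ 0 := by
    by_contra! hpos
    obtain ⟨n, hn⟩ := exists_nat_gt (4 * (∑ i, |x i|) / ∑ i, |y i|)
    rw [div_lt_iff₀ hpos] at hn
    have := hb n
    rw [nsmul_eq_mul] at this
    linarith
  have h0' := (Finset.sum_eq_zero_iff_of_nonneg fun i _ => abs_nonneg (y i)).1
    (le_antisymm h0 (Finset.sum_nonneg fun i _ => abs_nonneg _))
  ext i
  exact abs_eq_zero.1 (h0' i (Finset.mem_univ i))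

theorem maxGenEigenspace_stepMatrix (t₁ t₂ : V → V) {μ : ℝ} (hμ : |μ| = 2) :
    Module.End.maxGenEigenspace (Matrix.toLin' (stepMatrix ℝ t₁ t₂)) μ =
      Module.End.eigenspace (Matrix.toLin' (stepMatrix ℝ t₁ t₂)) μ := by
  set g := Matrix.toLin' (stepMatrix ℝ t₁ t₂) - μ • (1 : Module.End ℝ (V → ℝ)) with hg
  have hg' : ∀ x, g x = stepMatrix ℝ t₁ t₂ *ᵥ x - μ • x := fun x => by simp [hg]
  have hsq : ∀ x, g (g x) = 0 → g x = 0 := by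
    intro x hx
    refine stepMatrix_no_jordan_chain t₁ t₂ hμ (x := x) (y := g x) ?_ ?_
    · rw [hg']; abel
    · rw [hg' (g x), sub_eq_zero] at hx
      exact hx
  have hpow : ∀ k x, (g ^ k) x = 0 → g x = 0 := by
    intro k
    induction k with
    | zero => intro x hx; rw [show x = 0 by simpa using hx, map_zero]
    | succ k ih =>
      intro x hx
      rw [pow_succ, Module.End.mul_apply] at hx
      exact hsq x (ih _ hx)
  ext x
  rw [Module.End.mem_maxGenEigenspace, Module.End.mem_eigenspace_iff]
  constructor
  · rintro ⟨k, hk⟩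
    have := hpow k x hk
    rw [hg', sub_eq_zero] at this
    simpa using this
  · intro hx
    refine ⟨1, ?_⟩
    rw [pow_one]
    change g x = 0
    rw [hg', sub_eq_zero]
    simpa using hx

theorem finrank_ker_toLin'_transpose (M : Matrix V V ℝ) :
    Module.finrank ℝ (LinearMap.ker (Matrix.toLin' Mᵀ)) =
      Module.finrank ℝ (LinearMap.ker (Matrix.toLin' M)) := by
  have h1 := LinearMap.finrank_range_add_finrank_ker (Matrix.toLin' M)
  have h2 := LinearMap.finrank_range_add_finrank_ker (Matrix.toLin' Mᵀ)
  have h3 : Module.finrank ℝ (LinearMap.range (Matrix.toLin' Mᵀ)) =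
      Module.finrank ℝ (LinearMap.range (Matrix.toLin' M)) := Matrix.rank_transpose M
  omega

/-- The eigenspace of a step matrix for `μ = ±2` has dimension `#Q` if there are `#Q` vertices
`rep` that can be reached from everywhere, and a family of `#Q` eigenvectors separating them. -/
theorem finrank_eigenspace_stepMatrix {Q : Type*} [Fintype Q] (t₁ t₂ : V → V) {μ : ℝ}
    (hμ : |μ| = 2) (rep : Q → V)
    (hreach : ∀ v, ∃ a, Relation.ReflTransGen (fun a b => b = t₁ a ∨ b = t₂ a) v (rep a))
    (x : Q → V → ℝ) (hx : ∀ a, stepMatrix ℝ t₁ t₂ *ᵥ x a = μ • x a)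
    (hx1 : ∀ a, x a (rep a) ≠ 0) (hx0 : ∀ a b, a ≠ b → x a (rep b) = 0) :
    Module.finrank ℝ (Module.End.eigenspace (Matrix.toLin' (stepMatrix ℝ t₁ t₂)) μ) =
      Fintype.card Q := by
  classical
  have hE : Module.End.eigenspace (Matrix.toLin' (stepMatrix ℝ t₁ t₂)) μ =
      LinearMap.ker (Matrix.toLin' (stepMatrix ℝ t₁ t₂ - μ • 1)) := by
    ext y
    rw [Module.End.mem_eigenspace_iff, LinearMap.mem_ker, Matrix.toLin'_apply,
      Matrix.toLin'_apply, Matrix.sub_mulVec, Matrix.smul_mulVec, Matrix.one_mulVec, sub_eq_zero]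
  apply le_antisymm
  -- Left eigenvectors are determined by their values at the vertices `rep`.
  · rw [hE, ← finrank_ker_toLin'_transpose]
    have hinj : Function.Injective ((LinearMap.funLeft ℝ ℝ rep).comp
        (LinearMap.ker (Matrix.toLin' (stepMatrix ℝ t₁ t₂ - μ • 1)ᵀ)).subtype) := by
      rw [← LinearMap.ker_eq_bot, LinearMap.ker_eq_bot']
      rintro ⟨f, hf⟩ hf0
      rw [Subtype.ext_iff]
      refine left_eigenvector_eq_zero t₁ t₂ hμ (fun v => ?_) fun v => ?_
      · rw [LinearMap.mem_ker, Matrix.toLin'_apply, Matrix.mulVec_transpose, Matrix.vecMul_sub,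
          Matrix.vecMul_smul, Matrix.vecMul_one, sub_eq_zero] at hf
        rw [← vecMul_stepMatrix, hf]
        rfl
      · obtain ⟨a, ha⟩ := hreach v
        exact ⟨rep a, ha, congrFun hf0 a⟩
    simpa using LinearMap.finrank_le_finrank_of_injective hinj
  · let y : Q → Module.End.eigenspace (Matrix.toLin' (stepMatrix ℝ t₁ t₂)) μ := fun a =>
      ⟨x a, by rw [Module.End.mem_eigenspace_iff, Matrix.toLin'_apply, hx]⟩
    have hy : LinearIndependent ℝ y := by
      rw [Fintype.linearIndependent_iff]
      intro g hg b
      have h1 := congrFun (congrArg Subtype.val hg) (rep b)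
      simp only [AddSubmonoidClass.coe_finsetSum, Submodule.coe_smul, Finset.sum_apply,
        Pi.smul_apply, smul_eq_mul, ZeroMemClass.coe_zero, Pi.zero_apply, y] at h1
      rw [Finset.sum_eq_single b (fun a _ hab => by rw [hx0 a b hab, mul_zero]) (by simp)] at h1
      exact (mul_eq_zero.1 h1).resolve_right (hx1 b)
    exact hy.fintype_card_le_finrank

end StepMatrix

end Spectra

section Graph

open Complex

/-! ### Fixed points and double edges -/

theorem mem_regionI_of_L_eq {z : ℂ} (h : z ∈ D) (hL : L z = z) :
    z ∈ regionI ∧ normSq z = 1 / 2 := by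
  obtain ⟨h0, h1, h2, hn⟩ := denominators_pos h
  obtain ⟨h3, h4, h5⟩ := mem_D.1 h
  -- Comparing imaginary parts pins down the denominator of the formula for `L`.
  have hden : ∀ {e : ℝ}, 0 < e → z.im = 2 * z.im / e → e = 2 := by
    intro e he h'
    rw [eq_div_iff he.ne'] at h'
    nlinarith
  rcases outer_or_inner h with ho | hi
  · rcases outer_cases ho with hr | hr | hr
    · obtain ⟨hx, hy, hN⟩ := L_I hr
      rw [hL] at hy
      exact ⟨hr, by linarith [hden (by positivity) hy]⟩
    · obtain ⟨hx, hy, hN⟩ := L_II hr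
      rw [hL] at hy hN
      have he := hden h1 hy
      rw [he] at hN
      exact ⟨mem_regionI.2 ⟨h, by linarith, ho.2⟩, hN⟩
    · obtain ⟨hx, hy, hN⟩ := L_III hr
      rw [hL] at hy hN
      have he := hden h1 hy
      rw [he] at hN
      linarith
  · rcases inner_cases hi with hr | hr | hr
    · obtain ⟨hx, hy, hN⟩ := L_IV hr
      rw [hL] at hy
      have he := hden (by positivity) hy
      have := hi.2
      exact ⟨mem_regionI.2 ⟨h, by linarith, by linarith⟩, by linarith⟩
    · have := (L_V_or_VI (Or.inl hr)).2
      rw [hL] at this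
      linarith
    · have := (L_V_or_VI (Or.inr hr)).2
      rw [hL] at this
      linarith

theorem im_R {z : ℂ} (h : z ∈ D) : (R z).im = 2 * z.im / (4 * (normSq z - 2 * z.re + 1)) :=
  (outer_or_inner h).elim (fun h => (R_outer h).2.1) (fun h => (R_inner h).2.1)

theorem normSq_eq_of_R_eq {z : ℂ} (h : z ∈ D) (hR : R z = z) : normSq z = 2 * z.re - 1 / 2 := by
  obtain ⟨h0, h1, h2, hn⟩ := denominators_pos h
  have hy := im_R h
  have := (mem_D.1 h).2.1
  rw [hR, eq_div_iff (by positivity)] at hy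
  nlinarith

/-- On the circle `|z - 1 / 2| = 1 / 2` a fixed point of one of the maps is `1 / 2 + i / 2`, hence
also a fixed point of the other. -/
theorem R_eq_of_L_eq {z : ℂ} (h : z ∈ D) (hc : normSq z = z.re) (hL : L z = z) : R z = z := by
  obtain ⟨-, hn⟩ := mem_regionI_of_L_eq h hL
  refine (R_outer ⟨h, hc.ge⟩).ext ⟨rfl, rfl, rfl⟩ ?_ ?_ <;> rw [← hc, hn] <;> norm_num

theorem L_eq_of_R_eq {z : ℂ} (h : z ∈ D) (hc : normSq z = z.re) (hR : R z = z) : L z = z := by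
  have hn := normSq_eq_of_R_eq h hR
  have hI : z ∈ regionI := mem_regionI.2 ⟨h, by linarith, hc.ge⟩
  have hn' : normSq z = 1 / 2 := by linarith
  have hx' : z.re = 1 / 2 := by linarith
  refine (L_I hI).ext ⟨rfl, rfl, rfl⟩ ?_ ?_ <;> rw [hn'] <;> norm_num

theorem L_eq_of_R_eq_of_I {z : ℂ} (h : z ∈ regionI) (hR : R z = z) : L z = z := by
  have h' := (R_mem_inner h.1).2
  rw [hR] at h'
  exact L_eq_of_R_eq h.1 (le_antisymm h' (regionI_sub_outer h).2) hR

/-- The left and right triangles coincide only for isosceles triangles with apex over `1 / 2`. -/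
theorem re_eq_half_of_L_eq_R {z : ℂ} (h : z ∈ D) (hLR : L z = R z) : z.re = 1 / 2 := by
  obtain ⟨h0, h1, h2, hn⟩ := denominators_pos h
  obtain ⟨h3, h4, h5⟩ := mem_D.1 h
  have hR := im_R h
  rw [← hLR] at hR
  have hden : ∀ {e : ℝ}, 0 < e → (L z).im = 2 * z.im / e → e = 4 * (normSq z - 2 * z.re + 1) := by
    intro e he h'
    rw [h', div_eq_div_iff he.ne' (by positivity)] at hR
    exact (mul_left_cancel₀ (by positivity) hR).symm
  rcases outer_or_inner h with ho | hi
  · rcases outer_cases ho with hr | hr | hr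
    · linarith [hden (by positivity) (L_I hr).2.1]
    · linarith [hden h1 (L_II hr).2.1, (mem_regionII.1 hr).2.1]
    · linarith [hden h1 (L_III hr).2.1]
  · rcases inner_cases hi with hr | hr | hr
    · linarith [hden (by positivity) (L_IV hr).2.1]
    · have := hden one_pos (by rw [(L_V hr).2.1, div_one])
      linarith [(mem_regionV.1 hr).2.1]
    · have := hden one_pos (by rw [(L_VI hr).2.1, div_one])
      nlinarith [(mem_regionVI.1 hr).2.1, (mem_regionVI.1 hr).2.2]

/-- Targets of double edges lie on the circle `|w - 1 / 2| = 1 / 2`. -/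
theorem normSq_R_of_re_eq_half {z : ℂ} (h : z ∈ D) (hx : z.re = 1 / 2) :
    normSq (R z) = (R z).re := by
  rcases outer_or_inner h with ho | hi
  · rw [(R_outer ho).1, (R_outer ho).2.2, hx]; norm_num
  · rw [(R_inner hi).1, (R_inner hi).2.2, hx]; congr 1; ring

theorem L_eq_R_of_I {z : ℂ} (h : z ∈ regionI) (hx : z.re = 1 / 2) : L z = R z := by
  refine (L_I h).ext (R_outer (regionI_sub_outer h)) ?_ ?_ <;> rw [hx] <;> congr 1 <;> ring

theorem re_eq_half_of_normSq_R {z : ℂ} (h : z ∈ regionI) (hc : normSq (R z) = (R z).re) :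
    z.re = 1 / 2 := by
  obtain ⟨h0, h1, h2, hn⟩ := denominators_pos h.1
  rw [(R_outer (regionI_sub_outer h)).1, (R_outer (regionI_sub_outer h)).2.2,
    div_left_inj' (by positivity)] at hc
  linarith

theorem R_L_eq_of_normSq {z : ℂ} (h : z ∈ regionI) (hc : normSq z = z.re) : R (L z) = z := by
  have hre : (L z).re = 1 / 2 := by
    have := re_pos h.1
    rw [(L_I h).1, hc]; field_simp; norm_num
  rw [← L_eq_R_of_I (L_I_mem h) hre, L_L_of_I h]

theorem R_eq_L_of_R_mem_I {z : ℂ} (h : z ∈ regionI) (hR : R z ∈ regionI) : R z = L z :=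
  (L_eq_R_of_I h (re_eq_half_of_normSq_R h
    (le_antisymm (R_mem_inner h.1).2 (regionI_sub_outer hR).2))).symm

theorem IsDoubleTarget.normSq_eq {z w : ℂ} (hz : z ∈ D) (h : IsDoubleTarget z w) :
    w ∈ D ∧ normSq w = w.re := by
  obtain ⟨u, hu, hL, rfl⟩ := h
  have huD := orbit_subset_D hz hu
  exact ⟨R_mem_D huD, normSq_R_of_re_eq_half huD (re_eq_half_of_L_eq_R huD hL)⟩

theorem R_R_eq_of_L_eq {u : ℂ} (h : u ∈ regionI) (hu : L u = u) : R (R u) = R u := by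
  rw [← R_L_of_I h, hu]

theorem L_eq_of_R_R_eq {u : ℂ} (h : u ∈ regionI) (hu : R (R u) = R u) : L u = u := by
  rw [← L_R_R_of_outer (regionI_sub_outer h), hu, L_R_of_outer (regionI_sub_outer h)]

/-- A point of the terminal region that is fixed by `R` is the image of a fixed point of `L`. -/
theorem exists_of_R_eq {w : ℂ} (hw : w ∈ terminalRegion) (h : R w = w) :
    L w ∈ regionI ∧ L (L w) = L w ∧ R (L w) = w := by
  rcases hw with hw | ⟨u, hu, rfl⟩
  · rw [L_eq_of_R_eq_of_I hw h]
    exact ⟨hw, L_eq_of_R_eq_of_I hw h, h⟩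
  · rw [L_R_of_outer (regionI_sub_outer hu)]
    exact ⟨hu, L_eq_of_R_R_eq hu h, rfl⟩

theorem eq_or_eq_L_of_mem_orbit {u u' : ℂ} (hu : u ∈ regionI) (hu' : u' ∈ regionI)
    (h : u' ∈ orbit u) : u' = u ∨ u' = L u := by
  rcases orbit_subset_of_I hu h with rfl | rfl | rfl | rfl
  · exact Or.inl rfl
  · exact Or.inr rfl
  · exact Or.inr (R_eq_L_of_R_mem_I hu hu')
  · left
    rw [R_eq_L_of_R_mem_I (L_I_mem hu) hu', L_L_of_I hu]

theorem orbit_eq_of_mem_orbit {u u' : ℂ} (hu : u ∈ regionI) (hu' : u' ∈ regionI)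
    (h : u' ∈ orbit u) : orbit u' = orbit u := by
  refine (orbit_subset_orbit h).antisymm (orbit_subset_orbit ?_)
  rcases eq_or_eq_L_of_mem_orbit hu hu' h with rfl | rfl
  · exact self_mem_orbit _
  · have := L_mem_orbit (self_mem_orbit (L u))
    rwa [L_L_of_I hu] at this

theorem orbit_R_of_I {u : ℂ} (hu : u ∈ regionI) : orbit (R u) = orbit u := by
  refine (orbit_subset_orbit (R_mem_orbit (self_mem_orbit u))).antisymm (orbit_subset_orbit ?_)
  have := L_mem_orbit (self_mem_orbit (R u))
  rwa [L_R_of_outer (regionI_sub_outer hu)] at this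

theorem exists_mem_regionI_of_terminalQuadruple {z : ℂ} {Q : Set ℂ}
    (hQ : Q ∈ terminalQuadruples z) : ∃ u ∈ regionI, u ∈ orbit z ∧ Q = orbit u := by
  obtain ⟨w, ⟨hw, hA⟩, rfl⟩ := hQ
  rcases hA with hA | ⟨u, hu, rfl⟩
  · exact ⟨w, hA, hw, rfl⟩
  · have := L_mem_orbit hw
    rw [L_R_of_outer (regionI_sub_outer hu)] at this
    exact ⟨u, hu, this, orbit_R_of_I hu⟩

/-! ### The bisection graph -/

theorem bis_mem_orbit {z w : ℂ} (s : Side) (h : w ∈ orbit z) : bis s w ∈ orbit z := by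
  cases s
  exacts [L_mem_orbit h, R_mem_orbit h]

theorem isCopy_entry (z : ℂ) (s : Side) (w : ℂ) : IsCopy z w (entry z s w) := by
  unfold entry
  cases s <;> split_ifs <;> simp_all [IsCopy, bis, Side.other]

theorem target_fst {z w : ℂ} {c : Copy} (hc : IsCopy z w c) (s : Side) :
    (target z s (w, c)).1 = bis s w := by
  rcases c with _ | ⟨s', i⟩ | s'
  · rfl
  · have hc : bis s' w = w := hc
    cases s' <;> cases s <;> simp only [target] <;> (try split_ifs) <;>
      first | rfl | exact hc.symm
  · rfl

theorem isCopy_target {z w : ℂ} {c : Copy} (hw : w ∈ D) (hc : IsCopy z w c) (s : Side) :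
    IsCopy z (target z s (w, c)).1 (target z s (w, c)).2 := by
  rcases c with _ | ⟨s', i⟩ | s'
  · exact isCopy_entry _ _ _
  · have hc : bis s' w = w := hc
    cases s' <;> cases s <;> simp only [target] <;> (try split_ifs with hA)
    · exact hc
    · exact R_R_eq_of_L_eq (mem_regionI_of_L_eq hw hc).1 hc
    · exact isCopy_entry _ _ _
    · exact (exists_of_R_eq hA hc).2.1
    · exact isCopy_entry _ _ _
    · exact hc
  · exact isCopy_entry _ _ _

/-- The end of the edge labelled `s` that starts at a given vertex, as a vertex. -/
noncomputable def next {z : ℂ} (hz : z ∈ D) (s : Side) (v : Vertex z) : Vertex z :=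
  ⟨target z s v.1, by
    rw [show v.1 = (v.1.1, v.1.2) from rfl, target_fst v.2.2]
    exact bis_mem_orbit s v.2.1, isCopy_target (orbit_subset_D hz v.2.1) v.2.2 s⟩

theorem next_fst {z : ℂ} (hz : z ∈ D) (s : Side) (v : Vertex z) :
    (next hz s v).1.1 = bis s v.1.1 := target_fst v.2.2 s

/-- An edge labelled `L` and an edge labelled `R` that come from the same point elsewhere end at
different vertices. -/
theorem entry_left_ne_entry_right {z w : ℂ} (hz : z ∈ D) (h : IsDoubleTarget z w) :
    entry z .left w ≠ entry z .right w := by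
  obtain ⟨hD, hc⟩ := h.normSq_eq hz
  by_cases hL : L w = w
  · have hR := R_eq_of_L_eq hD hc hL
    simp [entry, bis, hL, hR]
  · have hR : R w ≠ w := fun hR => hL (L_eq_of_R_eq hD hc hR)
    simp [entry, bis, hL, hR, h, Side.other]

theorem next_left_ne_next_right {z : ℂ} (hz : z ∈ D) (v : Vertex z) :
    next hz .left v ≠ next hz .right v := by
  obtain ⟨⟨w, c⟩, hw, hc⟩ := v
  have hD := orbit_subset_D hz hw
  have main : (bis .left w, entry z .left (bis .left w)) ≠
      (bis .right w, entry z .right (bis .right w)) := by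
    intro he
    obtain ⟨h1, h2⟩ := Prod.ext_iff.1 he
    have h1 : L w = R w := h1
    refine entry_left_ne_entry_right hz (w := R w) ⟨w, hw, h1, rfl⟩ ?_
    rw [← h1]
    exact h2.trans (by rw [← show bis .right w = L w from h1.symm])
  intro he
  have he : target z .left (w, c) = target z .right (w, c) := congrArg Subtype.val he
  rcases c with _ | ⟨s', i⟩ | s'
  · exact main he
  · have hc : bis s' w = w := hc
    cases s'
    · have hA : w ∈ terminalRegion := Or.inl (mem_regionI_of_L_eq hD hc).1
      simp [target, hA] at he
    · by_cases hA : w ∈ terminalRegion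
      · simp [target, hA] at he
      · simp only [target, hA, if_false] at he
        have hL : L w = w := (Prod.ext_iff.1 he).1
        exact hA (Or.inl (mem_regionI_of_L_eq hD hL).1)
  · exact main he

theorem finite_vertex {z : ℂ} (hz : z ∈ D) : Finite (Vertex z) := by
  have h1 : Finite Copy := by
    refine Finite.of_injective (β := Option (Bool × Option Bool)) (fun c => match c with
      | .single => none
      | .loop .left i => some (true, some i)
      | .loop .right i => some (false, some i)
      | .double .left => some (true, none)
      | .double .right => some (false, none)) ?_
    rintro (_ | ⟨_ | _, i⟩ | _ | _) (_ | ⟨_ | _, j⟩ | _ | _) <;> simp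
  have h2 : ((orbit z) ×ˢ (Set.univ : Set Copy)).Finite := (tame_of_mem_D hz).1.prod Set.finite_univ
  have h3 : {p : ℂ × Copy | p.1 ∈ orbit z ∧ IsCopy z p.1 p.2}.Finite :=
    h2.subset fun p hp => ⟨hp.1, trivial⟩
  exact h3.to_subtype

/-- Since the two edges at a vertex have different ends, counting edges with multiplicity makes no
difference. -/
theorem adjMatrix_eq_stepMatrix {z : ℂ} (hz : z ∈ D) [DecidableEq (Vertex z)] :
    adjMatrix z = stepMatrix ℝ (next hz .left) (next hz .right) := by
  ext i j
  have hE : Edge z j i ↔ i = next hz .left j ∨ i = next hz .right j := by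
    constructor
    · rintro ⟨s | s, h⟩
      exacts [Or.inl (Subtype.ext h), Or.inr (Subtype.ext h)]
    · rintro (rfl | rfl)
      exacts [⟨.left, rfl⟩, ⟨.right, rfl⟩]
  have hne := next_left_ne_next_right hz j
  simp only [adjMatrix, stepMatrix, Matrix.of_apply, hE]
  by_cases h1 : i = next hz .left j
  · subst h1; simp [hne]
  · simp [h1]

/-- The vertex `v'` can be reached from the vertex `v` along the edges. -/
def Reach {z : ℂ} (hz : z ∈ D) : Vertex z → Vertex z → Prop :=
  Relation.ReflTransGen fun a b => b = next hz .left a ∨ b = next hz .right a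

theorem Reach.next {z : ℂ} {hz : z ∈ D} {v v' : Vertex z} (h : Reach hz v v') (s : Side) :
    Reach hz v (next hz s v') := by
  refine Relation.ReflTransGen.tail h ?_
  cases s
  exacts [Or.inl rfl, Or.inr rfl]

theorem exists_reach_of_mem_orbit {z : ℂ} (hz : z ∈ D) (v : Vertex z) {w : ℂ}
    (hw : w ∈ orbit v.1.1) : ∃ v', Reach hz v v' ∧ v'.1.1 = w := by
  induction hw with
  | refl => exact ⟨v, .refl, rfl⟩
  | tail _ hab ih =>
    obtain ⟨v', hv', rfl⟩ := ih
    rcases hab with rfl | rfl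
    exacts [⟨_, hv'.next .left, next_fst hz _ _⟩, ⟨_, hv'.next .right, next_fst hz _ _⟩]

/-! ### Terminal quadruples in the bisection graph -/

/-- The map induced by the label `s` on the four corners of an abstract terminal quadruple. The
corner `(a, .left)` stands for a point of region `I` and the corner `(a, .right)` for its right
triangle; the two points of region `I`, exchanged by `L`, are told apart by `a`. -/
def cornerStep : Side → Bool × Side → Bool × Side
  | .left, (a, .left) => (!a, .left)
  | .left, (a, .right) => (a, .left)
  | .right, (a, .left) => (a, .right)
  | .right, (a, .right) => (!a, .right)

/-- The points of the terminal quadruple of `u ∈ I`, some of which may coincide. -/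
noncomputable def cornerPoint (u : ℂ) : Bool × Side → ℂ
  | (false, .left) => u
  | (true, .left) => L u
  | (false, .right) => R u
  | (true, .right) => R (L u)

open scoped Classical in
/-- The copy of `cornerPoint u k` that represents the corner `k` in the bisection graph. -/
noncomputable def cornerCopy (z u : ℂ) (k : Bool × Side) : Copy :=
  if L u = u then .loop k.2 k.1
  else if IsDoubleTarget z (cornerPoint u k) then .double k.2
  else .single

theorem bis_cornerPoint {u : ℂ} (hu : u ∈ regionI) (s : Side) (k : Bool × Side) :
    bis s (cornerPoint u k) = cornerPoint u (cornerStep s k) := by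
  have hL := L_L_of_I hu
  have hR := L_R_of_outer (regionI_sub_outer hu)
  have hR' := L_R_of_outer (regionI_sub_outer (L_I_mem hu))
  have hRR := R_L_of_I hu
  have hRR' := R_L_of_I (L_I_mem hu)
  rw [hL] at hRR'
  rcases k with ⟨_ | _, _ | _⟩ <;> cases s <;>
    simp only [bis, cornerPoint, cornerStep, Bool.not_false, Bool.not_true] <;>
    first | assumption | (symm; assumption)

theorem cornerPoint_mem_orbit {z u : ℂ} (h : u ∈ orbit z) (k : Bool × Side) :
    cornerPoint u k ∈ orbit z := by
  rcases k with ⟨_ | _, _ | _⟩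
  exacts [h, R_mem_orbit h, L_mem_orbit h, R_mem_orbit (L_mem_orbit h)]

theorem cornerPoint_of_L_eq {u : ℂ} (hu : L u = u) (a : Bool) :
    cornerPoint u (a, .left) = u ∧ cornerPoint u (a, .right) = R u := by
  cases a <;> simp [cornerPoint, hu]

theorem cornerPoint_mem_terminalRegion {u : ℂ} (hu : u ∈ regionI) (k : Bool × Side) :
    cornerPoint u k ∈ terminalRegion := by
  rcases k with ⟨_ | _, _ | _⟩
  exacts [Or.inl hu, Or.inr ⟨u, hu, rfl⟩, Or.inl (L_I_mem hu), Or.inr ⟨L u, L_I_mem hu, rfl⟩]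

/-- The four points of a terminal quadruple have no loops unless they are a pair of loops. -/
theorem bis_cornerPoint_ne {u : ℂ} (hu : u ∈ regionI) (hne : L u ≠ u) (s : Side)
    (k : Bool × Side) : bis s (cornerPoint u k) ≠ cornerPoint u k := by
  have key : ∀ u ∈ regionI, L u ≠ u → R u ≠ u ∧ L (R u) ≠ R u ∧ R (R u) ≠ R u := by
    intro u hu hne
    have hR : R u ≠ u := fun h => hne (L_eq_of_R_eq_of_I hu h)
    refine ⟨hR, ?_, fun h => hne (L_eq_of_R_R_eq hu h)⟩
    rw [L_R_of_outer (regionI_sub_outer hu)]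
    exact hR.symm
  have hne' : L (L u) ≠ L u := by rw [L_L_of_I hu]; exact hne.symm
  obtain ⟨h1, h2, h3⟩ := key u hu hne
  obtain ⟨h1', h2', h3'⟩ := key _ (L_I_mem hu) hne'
  rcases k with ⟨_ | _, _ | _⟩ <;> cases s <;> assumption

theorem isCopy_cornerCopy {z u : ℂ} (hu : u ∈ regionI) (k : Bool × Side) :
    IsCopy z (cornerPoint u k) (cornerCopy z u k) := by
  unfold cornerCopy
  split_ifs with h1 h2
  · obtain ⟨a, _ | _⟩ := k
    · rw [(cornerPoint_of_L_eq h1 a).1]; exact h1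
    · rw [(cornerPoint_of_L_eq h1 a).2]; exact R_R_eq_of_L_eq hu h1
  · exact ⟨bis_cornerPoint_ne hu h1 .left k, bis_cornerPoint_ne hu h1 .right k, h2⟩
  · exact ⟨bis_cornerPoint_ne hu h1 .left k, bis_cornerPoint_ne hu h1 .right k, h2⟩

/-- The vertex of the bisection graph at the corner `k` of the terminal quadruple of `u ∈ I`. -/
noncomputable def corner {z u : ℂ} (hu : u ∈ regionI) (huz : u ∈ orbit z) (k : Bool × Side) :
    Vertex z :=
  ⟨(cornerPoint u k, cornerCopy z u k), cornerPoint_mem_orbit huz k, isCopy_cornerCopy hu k⟩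

/-- The corners of a terminal quadruple span a 4-cycle with edges in both directions, whether or
not some of its points coincide. -/
theorem next_corner {z u : ℂ} (hz : z ∈ D) (hu : u ∈ regionI) (huz : u ∈ orbit z) (s : Side)
    (k : Bool × Side) : next hz s (corner hu huz k) = corner hu huz (cornerStep s k) := by
  apply Subtype.ext
  have hfst := (next_fst hz s (corner hu huz k)).trans (bis_cornerPoint hu s k)
  refine Prod.ext hfst ?_
  -- An edge labelled `s` always leads to a corner of type `s`, which matches the copy `entry z s`.
  have hk : (cornerStep s k).2 = s := by
    rcases k with ⟨_ | _, _ | _⟩ <;> cases s <;> rfl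
  by_cases h : L u = u
  · have hA := cornerPoint_mem_terminalRegion hu k
    rcases k with ⟨a, _ | _⟩ <;> cases s <;>
      simp [next, corner, cornerCopy, h, target, cornerStep, hA]
  · have hne := bis_cornerPoint_ne hu h
    have htgt : (target z s (cornerPoint u k, cornerCopy z u k)).2 =
        entry z s (bis s (cornerPoint u k)) := by
      unfold cornerCopy
      rw [if_neg h]
      split_ifs <;> rfl
    change (target z s (cornerPoint u k, cornerCopy z u k)).2 = cornerCopy z u (cornerStep s k)
    rw [htgt, bis_cornerPoint hu, entry, cornerCopy, if_neg (hne _ _), if_neg (hne _ _), if_neg h,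
      hk]

theorem corner_reach {z u : ℂ} (hz : z ∈ D) (hu : u ∈ regionI) (huz : u ∈ orbit z)
    (k k' : Bool × Side) : Reach hz (corner hu huz k) (corner hu huz k') := by
  have h1 : ∀ s, Reach hz (corner hu huz k) (corner hu huz (cornerStep s k)) := fun s => by
    rw [← next_corner hz]
    exact Reach.next .refl s
  have h2 : ∀ s s', Reach hz (corner hu huz k) (corner hu huz (cornerStep s' (cornerStep s k))) :=
    fun s s' => by
      rw [← next_corner hz hu huz s']
      exact (h1 s).next s'
  rcases k with ⟨_ | _, _ | _⟩ <;> rcases k' with ⟨_ | _, _ | _⟩ <;>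
    first | exact h1 .left | exact h1 .right | exact h2 .left .left | exact h2 .left .right

/-- The corner `(false, .left)` is not identified with any other corner: whenever two of the
points coincide, the corresponding copies differ. -/
theorem corner_injective_at {z u : ℂ} (hu : u ∈ regionI) (huz : u ∈ orbit z) {k : Bool × Side}
    (h : corner hu huz k = corner hu huz (false, .left)) : k = (false, .left) := by
  obtain ⟨hp, hc⟩ := Prod.ext_iff.1 (congrArg Subtype.val h)
  change cornerPoint u k = u at hp
  change cornerCopy z u k = cornerCopy z u (false, .left) at hc
  by_cases hL : L u = u
  · obtain ⟨a, b⟩ := k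
    simp only [cornerCopy, hL, if_true, Copy.loop.injEq] at hc
    rw [hc.1, hc.2]
  · rcases k with ⟨_ | _, _ | _⟩
    · rfl
    · exact absurd (L_eq_of_R_eq_of_I hu hp) hL
    · exact absurd hp hL
    · have hd : IsDoubleTarget z u := ⟨L u, L_mem_orbit huz, L_L_of_I hu, hp⟩
      have hp' : R (L u) = u := hp
      simp [cornerCopy, hL, cornerPoint, hp', hd] at hc

/-- All vertices over the terminal region are corners of terminal quadruples. -/
theorem exists_eq_corner {z : ℂ} (hz : z ∈ D) (v : Vertex z) (hv : v.1.1 ∈ terminalRegion) :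
    ∃ (u : ℂ) (hu : u ∈ regionI) (huz : u ∈ orbit z) (k : Bool × Side), v = corner hu huz k := by
  obtain ⟨⟨p, c⟩, hp, hc⟩ := v
  change p ∈ terminalRegion at hv
  change p ∈ orbit z at hp
  suffices h : ∃ u ∈ regionI, u ∈ orbit z ∧ ∃ k, p = cornerPoint u k ∧ c = cornerCopy z u k by
    obtain ⟨u, hu, huz, k, h1, h2⟩ := h
    exact ⟨u, hu, huz, k, Subtype.ext (Prod.ext h1 h2)⟩
  have hLR : ∀ {u}, u ∈ regionI → p = R u → u = L p := fun hu h => by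
    rw [h, L_R_of_outer (regionI_sub_outer hu)]
  have hpL := L_mem_orbit hp
  rcases c with _ | ⟨_ | _, i⟩ | s
  · obtain ⟨h1, h2, h3⟩ := hc
    rcases hv with hv | ⟨u, hu, hpu⟩
    · exact ⟨p, hv, hp, (false, .left), rfl, by simp [cornerCopy, cornerPoint, h1, h3]⟩
    · have huz : u ∈ orbit z := hLR hu hpu.symm ▸ hpL
      subst hpu
      have hne : L u ≠ u := fun h => h2 (R_R_eq_of_L_eq hu h)
      exact ⟨u, hu, huz, (false, .right), rfl, by simp [cornerCopy, cornerPoint, hne, h3]⟩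
  · have hc : L p = p := hc
    refine ⟨p, (mem_regionI_of_L_eq (orbit_subset_D hz hp) hc).1, hp, (i, .left),
      (cornerPoint_of_L_eq hc i).1.symm, by simp [cornerCopy, hc]⟩
  · have hc : R p = p := hc
    obtain ⟨h1, h2, h3⟩ := exists_of_R_eq hv hc
    refine ⟨L p, h1, hpL, (i, .right), ?_, by simp [cornerCopy, h2]⟩
    rw [(cornerPoint_of_L_eq h2 i).2, h3]
  · obtain ⟨h1, h2, h3⟩ := hc
    have hcirc := (h3.normSq_eq hz).2
    -- A double target in the terminal region lies both in region `I` and in its image under `R`.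
    have hpI : p ∈ regionI := by
      rcases hv with hv | ⟨u, hu, rfl⟩
      · exact hv
      · rw [← L_eq_R_of_I hu (re_eq_half_of_normSq_R hu hcirc)]
        exact L_I_mem hu
    have hRL := R_L_eq_of_normSq hpI hcirc
    cases s
    · exact ⟨p, hpI, hp, (false, .left), rfl, by simp [cornerCopy, cornerPoint, h1, h3]⟩
    · refine ⟨L p, L_I_mem hpI, hpL, (false, .right), hRL.symm, ?_⟩
      have hne : L (L p) ≠ L p := by rw [L_L_of_I hpI]; exact h1.symm
      rw [cornerCopy, if_neg hne, if_pos]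
      rw [show cornerPoint (L p) (false, .right) = p from hRL]
      exact h3

/-- The terminal quadruples of `u` and of another point `u'` of region `I` in its orbit have the
same corners, although the labels `a` of the corners may be exchanged. -/
theorem exists_corner_eq_corner {z u u' : ℂ} (hu : u ∈ regionI) (huz : u ∈ orbit z)
    (hu' : u' ∈ regionI) (huz' : u' ∈ orbit z) (h : u' ∈ orbit u) :
    ∃ k, corner hu huz k = corner hu' huz' (false, .left) := by
  by_cases hL : L u = u
  · have : u' = u := by simpa [hL] using eq_or_eq_L_of_mem_orbit hu hu' h
    subst this
    exact ⟨_, rfl⟩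
  · rcases eq_or_eq_L_of_mem_orbit hu hu' h with rfl | rfl
    · exact ⟨_, rfl⟩
    · refine ⟨(true, .left), Subtype.ext (Prod.ext rfl ?_)⟩
      have hne : L (L u) ≠ L u := by rw [L_L_of_I hu]; exact Ne.symm hL
      simp [corner, cornerCopy, hL, hne, cornerPoint]
      rfl

/-- The function on the vertices with the values `1, ε, ε, 1` along the 4-cycle of a terminal
quadruple, and `0` elsewhere. -/
noncomputable def cornerVector {z u : ℂ} [DecidableEq (Vertex z)] (hu : u ∈ regionI)
    (huz : u ∈ orbit z) (ε : ℝ) : Vertex z → ℝ :=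
  Pi.single (corner hu huz (false, .left)) 1 + Pi.single (corner hu huz (true, .right)) 1 +
    ε • (Pi.single (corner hu huz (true, .left)) 1 + Pi.single (corner hu huz (false, .right)) 1)

theorem stepMatrix_mulVec_cornerVector {z u : ℂ} (hz : z ∈ D) [Fintype (Vertex z)]
    [DecidableEq (Vertex z)] (hu : u ∈ regionI) (huz : u ∈ orbit z) {ε : ℝ} (hε : ε * ε = 1) :
    Matrix.mulVec (stepMatrix ℝ (next hz .left) (next hz .right)) (cornerVector hu huz ε) =
      (2 * ε) • cornerVector hu huz ε := by
  simp only [cornerVector, Matrix.mulVec_add, Matrix.mulVec_smul, stepMatrix_mulVec_single,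
    next_corner, cornerStep, Bool.not_true, Bool.not_false]
  ext v
  simp only [Pi.add_apply, Pi.smul_apply, smul_eq_mul]
  linear_combination (-2 * ((Pi.single (corner hu huz (true, .left)) 1 : Vertex z → ℝ) v +
    (Pi.single (corner hu huz (false, .right)) 1 : Vertex z → ℝ) v)) * hε

theorem cornerVector_apply_self {z u : ℂ} [DecidableEq (Vertex z)] (hu : u ∈ regionI)
    (huz : u ∈ orbit z) (ε : ℝ) : cornerVector hu huz ε (corner hu huz (false, .left)) = 1 := by
  have h : ∀ k, k ≠ (false, .left) →
      (Pi.single (corner hu huz k) 1 : Vertex z → ℝ) (corner hu huz (false, .left)) = 0 := by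
    intro k hk
    rw [Pi.single_apply, if_neg]
    exact fun h => hk (corner_injective_at hu huz h.symm)
  simp [cornerVector, h]

theorem cornerVector_apply_of_ne {z u : ℂ} [DecidableEq (Vertex z)] (hu : u ∈ regionI)
    (huz : u ∈ orbit z) (ε : ℝ) {v : Vertex z} (hv : v.1.1 ∉ orbit u) :
    cornerVector hu huz ε v = 0 := by
  have h : ∀ k, (Pi.single (corner hu huz k) 1 : Vertex z → ℝ) v = 0 := by
    intro k
    rw [Pi.single_apply, if_neg]
    rintro rfl
    exact hv (cornerPoint_mem_orbit (self_mem_orbit u) k)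
  simp [cornerVector, h]

theorem finite_terminalQuadruples {z : ℂ} (hz : z ∈ D) : (terminalQuadruples z).Finite := by
  refine ((tame_of_mem_D hz).1.image orbit).subset ?_
  rintro Q ⟨w, hw, rfl⟩
  exact ⟨w, hw.1, rfl⟩

theorem q_pos {z : ℂ} (hz : z ∈ D) : 0 < q z := by
  rw [q, Set.ncard_pos (finite_terminalQuadruples hz)]
  obtain ⟨w, hw, hI⟩ := (tame_of_mem_D hz).2
  exact ⟨orbit w, w, ⟨hw, Or.inl hI⟩, rfl⟩

/-- The eigenspaces for `2` and `-2` have dimension `q z`. -/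
theorem finrank_eigenspace_eq_q {z : ℂ} (hz : z ∈ D) [Fintype (Vertex z)]
    [DecidableEq (Vertex z)] {ε : ℝ} (hε : ε * ε = 1) :
    Module.finrank ℝ (Module.End.eigenspace
      (Matrix.toLin' (stepMatrix ℝ (next hz .left) (next hz .right))) (2 * ε)) = q z := by
  have := (finite_terminalQuadruples hz).fintype
  choose u huI huz hu using fun Q : terminalQuadruples z =>
    exists_mem_regionI_of_terminalQuadruple Q.2
  have hμ : |2 * ε| = 2 := by
    have : |ε| = 1 := by
      rcases mul_self_eq_one_iff.1 hε with rfl | rfl <;> simp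
    rw [abs_mul, this]; norm_num
  rw [finrank_eigenspace_stepMatrix _ _ hμ (fun Q => corner (huI Q) (huz Q) (false, .left)) ?_
    (fun Q => cornerVector (huI Q) (huz Q) ε) ?_ ?_ ?_]
  · rw [q, ← Nat.card_coe_set_eq, Nat.card_eq_fintype_card]
  · intro v
    have hvD := orbit_subset_D hz v.2.1
    obtain ⟨w, hw, hwI⟩ := (tame_of_mem_D hvD).2
    obtain ⟨v', hv', hv'w⟩ := exists_reach_of_mem_orbit hz v hw
    obtain ⟨t, htI, htz, k, rfl⟩ := exists_eq_corner hz v' (by rw [hv'w]; exact Or.inl hwI)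
    let Q : terminalQuadruples z := ⟨orbit t, t, ⟨htz, Or.inl htI⟩, rfl⟩
    have hQ : u Q ∈ orbit t := by
      rw [show orbit t = orbit (u Q) from hu Q]
      exact self_mem_orbit _
    obtain ⟨k', hk'⟩ := exists_corner_eq_corner htI htz (huI Q) (huz Q) hQ
    refine ⟨Q, hv'.trans ?_⟩
    rw [← hk']
    exact corner_reach hz htI htz k k'
  · exact fun Q => stepMatrix_mulVec_cornerVector hz (huI Q) (huz Q) hε
  · intro Q
    rw [cornerVector_apply_self]
    exact one_ne_zero
  · intro Q Q' hne
    refine cornerVector_apply_of_ne _ _ _ fun h => hne ?_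
    rw [Subtype.ext_iff, hu Q, hu Q']
    exact (orbit_eq_of_mem_orbit (huI Q) (huI Q') h).symm

end Graph

end LEB

theorem lemma3p4 (z : ℂ) (hz : z ∈ LEB.D) :
    Finite (LEB.Vertex z) ∧
    ∀ [Fintype (LEB.Vertex z)] [DecidableEq (LEB.Vertex z)],
      -- (a) `2` is an eigenvalue, and it is the spectral radius (over all complex eigenvalues)
      Module.End.HasEigenvalue (Matrix.toLin' (LEB.adjMatrix z)) 2 ∧
      spectralRadius ℂ ((LEB.adjMatrix z).map (fun x : ℝ => (x : ℂ))) = 2 ∧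
      -- (b) dimensions of the eigenspaces, and triviality of the Jordan blocks
      Module.finrank ℝ (Module.End.eigenspace (Matrix.toLin' (LEB.adjMatrix z)) 2) = LEB.q z ∧
      Module.finrank ℝ (Module.End.eigenspace (Matrix.toLin' (LEB.adjMatrix z)) (-2)) = LEB.q z ∧
      Module.End.maxGenEigenspace (Matrix.toLin' (LEB.adjMatrix z)) 2 =
        Module.End.eigenspace (Matrix.toLin' (LEB.adjMatrix z)) 2 ∧
      Module.End.maxGenEigenspace (Matrix.toLin' (LEB.adjMatrix z)) (-2) =
        Module.End.eigenspace (Matrix.toLin' (LEB.adjMatrix z)) (-2) := by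
  refine ⟨LEB.finite_vertex hz, ?_⟩
  intro _ _
  rw [LEB.adjMatrix_eq_stepMatrix hz]
  set M := LEB.stepMatrix ℝ (LEB.next hz .left) (LEB.next hz .right) with hM
  have h2 : Module.finrank ℝ (Module.End.eigenspace (Matrix.toLin' M) 2) = LEB.q z := by
    have := LEB.finrank_eigenspace_eq_q hz (ε := 1) (by norm_num)
    rwa [mul_one] at this
  have hn2 : Module.finrank ℝ (Module.End.eigenspace (Matrix.toLin' M) (-2)) = LEB.q z := by
    have := LEB.finrank_eigenspace_eq_q hz (ε := -1) (by norm_num)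
    rwa [mul_neg_one] at this
  have hne : Nonempty (LEB.Vertex z) := by
    obtain ⟨u, hu, hI⟩ := (LEB.tame_of_mem_D hz).2
    exact ⟨LEB.corner hI hu (false, .left)⟩
  refine ⟨?_, ?_, h2, hn2, LEB.maxGenEigenspace_stepMatrix _ _ (by norm_num),
    LEB.maxGenEigenspace_stepMatrix _ _ (by norm_num)⟩
  · intro hbot
    have := LEB.q_pos hz
    rw [← h2, show Module.End.eigenspace (Matrix.toLin' M) 2 = ⊥ from hbot] at this
    simp at this
  · have hmap : M.map (fun x : ℝ => (x : ℂ)) =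
        LEB.stepMatrix ℂ (LEB.next hz .left) (LEB.next hz .right) := by
      ext i j
      simp only [hM, LEB.stepMatrix, Matrix.map_apply, Matrix.of_apply]
      split_ifs <;> norm_num
    rw [hmap]
    exact LEB.spectralRadius_stepMatrix _ _
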